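/- Let $\Gamma\subset\mathbb{R}^k$ be a nonempty compact smooth embedded submanifold without boundary, of dimension $d$ (any codimension). Let $\rho(x)=\operatorname{dist}(x,\Gamma)$, $U_\delta(\Gamma)=\{\rho<\delta\}$, let $p$ be the closest point projection onto $\Gamma$, and let $P_\Gamma(q)$ be the orthogonal projection of $\mathbb{R}^k$ onto the tangent space $T_q\Gamma$. Then there is $\delta_0>0$ such that every point of $U_{\delta_0}(\Gamma)$ has a unique closest point on $\Gamma$, $p$ is smooth on $U_{\delta_0}(\Gamma)$, and there is a bounded matrix-valued function $H$ on $U_{\delta_0}(\Gamma)$ with $$Dp(x)=P_\Gamma(p(x))\,(I-\rho(x)H(x)),\qquad H(x)P_\Gamma(p(x))=H(x).$$ Moreover, for every constant $c$ there are constants $C,h_0>0$ (depending only on $\Gamma$, $\delta_0$ and $c$) such that the following holds for every such $H$, every $0<h\le h_0$ and every discrete manifold $\Gamma_h=\bigcup_{K\in\mathcal K_h}K$, where $\mathcal K_h$ is a finite conforming mesh without boundary of nondegenerate $d$-simplices in $\mathbb{R}^k$ with $\Gamma_h\subset U_{\delta_0}(\Gamma)$, $p:\Gamma_h\to\Gamma$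 bijective, and $$\|\rho\|_{L^\infty(\Gamma_h)}\le c\,h^2,\qquad \|P_\Gamma\circ p-P_{\Gamma_h}\|_{L^\infty(\Gamma_h)}\le c\,h .$$ Here $P_{\Gamma_h}$ is, on each $K$, the orthogonal projection onto the direction space of the affine hull of $K$, and norms of matrices are operator norms. For $x\in K\in\mathcal K_h$ put $$B=P_\Gamma(p(x))\,(I-\rho(x) H(x))\,P_{\Gamma_h}:\;T_xK\to T_{p(x)}\Gamma ,$$ and let $|B|_d$ be the absolute value of the determinant of this linear map with respect to orthonormal bases of $T_xK$ and $T_{p(x)}\Gamma$. Then, for all $K\in\mathcal K_h$ and $x\in K$: 1. $\|B\|\le C$, $B$ is invertible with $\|B^{-1}\|\le C$, and $\|P_\Gamma(p(x))-BB^T\|\le C h^2$; 2. $\bigl|1-|B|_d\bigr|\le C h^2$, $|B|_d\le C$, $|B|_d>0$ and $|B|_d^{-1}\le C$. Consequently, writing $d\Gamma$ and $d\Gamma_h$ for the $d$-dimensional Riemannian (surface) measures, every Borel set $\omega\subset\Gamma_h$ has finite measure and satisfies $$\int_{p(\omega)}d\Gamma=\int_\omega |B|_d\,d\Gamma_h=\sum_{K\in\mathcal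 K_h}\int_{\omega\cap K}|B|_d\,d\Gamma_h,\qquad \Bigl|\int_{p(\omega)}d\Gamma-\int_{\omega}d\Gamma_h\Bigr|\le C h^2\int_{\omega}d\Gamma_h .$$ -/

import Mathlib

open Set MeasureTheory
open scoped ContDiff ENNReal

noncomputable section

namespace CutFEM

/-- The ambient Euclidean space `ℝᵏ`. -/
abbrev Amb (k : ℕ) : Type := EuclideanSpace ℝ (Fin k)

/-- `Γ` is a smooth `d`-dimensional embedded submanifold (without boundary) of `ℝᵏ`: near each of
its points it is the homeomorphic image of an open subset of `ℝᵈ` under a smooth immersion. -/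
def IsSmoothSubmanifold {k : ℕ} (d : ℕ) (Γ : Set (Amb k)) : Prop :=
  ∀ q ∈ Γ, ∃ (U : Set (Amb k)) (V : Set (EuclideanSpace ℝ (Fin d)))
    (α : EuclideanSpace ℝ (Fin d) → Amb k) (β : Amb k → EuclideanSpace ℝ (Fin d)),
    IsOpen U ∧ q ∈ U ∧ IsOpen V ∧ α '' V = Γ ∩ U ∧
    ContDiffOn ℝ ∞ α V ∧ (∀ y ∈ V, Function.Injective (fderiv ℝ α y)) ∧
    ContinuousOn β (Γ ∩ U) ∧ LeftInvOn β α V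

/-- The tangent space `T_q Γ`: the linear span of the limits of secant directions of `Γ` at `q`. -/
def tangentSpace {k : ℕ} (Γ : Set (Amb k)) (q : Amb k) : Submodule ℝ (Amb k) :=
  Submodule.span ℝ (tangentConeAt ℝ Γ q)

/-- The orthogonal projection `P_Γ` of `ℝᵏ` onto `T_q Γ`. -/
def tangentProj {k : ℕ} (Γ : Set (Amb k)) (q : Amb k) : Amb k →L[ℝ] Amb k :=
  (tangentSpace Γ q).starProjection

/-- The tubular neighbourhood `U_δ(Γ)`; the distance function `ρ` is `Metric.infDist · Γ`. -/
def tube {k : ℕ} (Γ : Set (Amb k)) (δ : ℝ) : Set (Amb k) :=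
  {x | Metric.infDist x Γ < δ}

open Classical in
/-- The closest point projection `p`, where a closest point exists (and `x` elsewhere). -/
def closestPoint {k : ℕ} (Γ : Set (Amb k)) (x : Amb k) : Amb k :=
  if h : ∃ q ∈ Γ, dist x q = Metric.infDist x Γ then h.choose else x

/-- `p` is a well-defined smooth map on the tube of radius `δ`. -/
structure IsTubeRadius {k : ℕ} (Γ : Set (Amb k)) (δ : ℝ) : Prop where
  pos : 0 < δ
  existsUnique_closest : ∀ x ∈ tube Γ δ, ∃! q, q ∈ Γ ∧ dist x q = Metric.infDist x Γ
  contDiffOn : ContDiffOn ℝ ∞ (closestPoint Γ) (tube Γ δ)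

/-- `H` is a bounded matrix field on the tube with `Dp = P_Γ (I - ρ H)` and `H P_Γ = H`. -/
structure IsTubeFactor {k : ℕ} (Γ : Set (Amb k)) (δ : ℝ) (H : Amb k → Amb k →L[ℝ] Amb k) :
    Prop where
  fderiv_eq : ∀ x ∈ tube Γ δ, fderiv ℝ (closestPoint Γ) x =
    tangentProj Γ (closestPoint Γ x) ∘L
      (ContinuousLinearMap.id ℝ (Amb k) - Metric.infDist x Γ • H x)
  comp_proj : ∀ x ∈ tube Γ δ, H x ∘L tangentProj Γ (closestPoint Γ x) = H x
  bounded : ∃ M : ℝ, ∀ x ∈ tube Γ δ, ‖H x‖ ≤ M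

/-- The `d`-dimensional simplices of a mesh, given by their vertices. -/
def cells {k : ℕ} (d : ℕ) (𝒦 : Geometry.SimplicialComplex ℝ (Amb k)) : Set (Finset (Amb k)) :=
  {K ∈ 𝒦.faces | K.card = d + 1}

/-- A finite conforming mesh of nondegenerate `d`-simplices without boundary: every face lies in a
`d`-simplex, and every `(d-1)`-dimensional face in exactly two of them. -/
structure IsClosedMesh {k : ℕ} (d : ℕ) (𝒦 : Geometry.SimplicialComplex ℝ (Amb k)) : Prop where
  finite : 𝒦.faces.Finite
  pure : ∀ s ∈ 𝒦.faces, ∃ K ∈ cells d 𝒦, s ⊆ K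
  closed : ∀ s ∈ 𝒦.faces, s.card = d → {K ∈ cells d 𝒦 | s ⊆ K}.ncard = 2

/-- The orthogonal projection `P_{Γ_h}` on the simplex with vertex set `K`, whose tangent space is
`vectorSpan ℝ K`, the direction of its affine hull. -/
def cellProj {k : ℕ} (K : Finset (Amb k)) : Amb k →L[ℝ] Amb k :=
  (vectorSpan ℝ (K : Set (Amb k))).starProjection

/-- The requirements on a discrete manifold `Γ_h = 𝒦.space` with mesh parameter `h`; `c` is the
constant in `‖ρ‖ ≤ c h²` and `‖P_Γᵉ - P_{Γ_h}‖ ≤ c h`. -/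
structure IsDiscreteManifold {k : ℕ} (d : ℕ) (Γ : Set (Amb k)) (δ c h : ℝ)
    (𝒦 : Geometry.SimplicialComplex ℝ (Amb k)) : Prop where
  mesh : IsClosedMesh d 𝒦
  subset_tube : 𝒦.space ⊆ tube Γ δ
  bijOn : BijOn (closestPoint Γ) 𝒦.space Γ
  dist_le : ∀ x ∈ 𝒦.space, Metric.infDist x Γ ≤ c * h ^ 2
  proj_le : ∀ K ∈ cells d 𝒦, ∀ x ∈ convexHull ℝ (K : Set (Amb k)),
    ‖tangentProj Γ (closestPoint Γ x) - cellProj K‖ ≤ c * h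

/-- `B = P_Γ (I - ρ H) P_{Γ_h}` at the point `x` of the simplex `K`, as a `k × k` matrix. -/
def matB {k : ℕ} (Γ : Set (Amb k)) (H : Amb k → Amb k →L[ℝ] Amb k) (K : Finset (Amb k))
    (x : Amb k) : Amb k →L[ℝ] Amb k :=
  tangentProj Γ (closestPoint Γ x) ∘L
    (ContinuousLinearMap.id ℝ (Amb k) - Metric.infDist x Γ • H x) ∘L cellProj K

lemma matB_mem {k : ℕ} (Γ : Set (Amb k)) (H : Amb k → Amb k →L[ℝ] Amb k) (K : Finset (Amb k))
    (x v : Amb k) : matB Γ H K x v ∈ tangentSpace Γ (closestPoint Γ x) :=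
  Submodule.starProjection_apply_mem _ _

/-- `B` as a linear map `T_x Γ_h → T_{p(x)} Γ` between the tangent spaces. -/
def tanB {k : ℕ} (Γ : Set (Amb k)) (H : Amb k → Amb k →L[ℝ] Amb k) (K : Finset (Amb k))
    (x : Amb k) :
    vectorSpan ℝ (K : Set (Amb k)) →L[ℝ] tangentSpace Γ (closestPoint Γ x) :=
  (matB Γ H K x ∘L (vectorSpan ℝ (K : Set (Amb k))).subtypeL).codRestrict _
    (fun v => matB_mem Γ H K x v)

/-- The absolute value of the determinant of a linear map between Euclidean spaces of equal
dimension, as the square root of its Gram determinant (see `absDet_eq`). -/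
def absDet {V W : Type*} [NormedAddCommGroup V] [InnerProductSpace ℝ V] [FiniteDimensional ℝ V]
    [NormedAddCommGroup W] [InnerProductSpace ℝ W] [FiniteDimensional ℝ W] (A : V →L[ℝ] W) : ℝ :=
  √(LinearMap.det (LinearMap.adjoint (A : V →ₗ[ℝ] W) ∘ₗ (A : V →ₗ[ℝ] W)))

/-- `absDet A = |det ⟨e_i, A f_j⟩|` for all orthonormal bases `f` of `V` and `e` of `W`. -/
theorem absDet_eq {V W : Type*} [NormedAddCommGroup V] [InnerProductSpace ℝ V]
    [FiniteDimensional ℝ V] [NormedAddCommGroup W] [InnerProductSpace ℝ W] [FiniteDimensional ℝ W]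
    {d : ℕ} (f : OrthonormalBasis (Fin d) ℝ V) (e : OrthonormalBasis (Fin d) ℝ W)
    (A : V →L[ℝ] W) :
    absDet A = |(Matrix.of fun i j => inner ℝ (e i) (A (f j)) : Matrix _ _ ℝ).det| := by
  have h1 : (Matrix.of fun i j => inner ℝ (e i) (A (f j)) : Matrix _ _ ℝ) =
      LinearMap.toMatrix f.toBasis e.toBasis (A : V →ₗ[ℝ] W) := by
    ext i j
    simp [LinearMap.toMatrix_apply, OrthonormalBasis.repr_apply_apply]
  rw [absDet, ← LinearMap.det_toMatrix f.toBasis, LinearMap.toMatrix_comp _ e.toBasis,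
    LinearMap.toMatrix_adjoint, h1, Matrix.det_mul, Matrix.det_conjTranspose, star_trivial,
    Real.sqrt_mul_self_eq_abs]

/-- The `d`-dimensional Riemannian measure on `d`-dimensional (piecewise) smooth subsets of `ℝᵏ`:
the `d`-dimensional Hausdorff measure, normalized to agree with Lebesgue measure on `ℝᵈ`. -/
def riemMeasure {k : ℕ} (d : ℕ) : Measure (Amb k) :=
  Measure.euclideanHausdorffMeasure d

end CutFEM

end

/-! In a chart `α` of `Γ`, the coordinates `y` of a closest point to `x` satisfy `⟨x - α y, Dα(y) w⟩
= 0` for all `w` (`critEq`). At `x = α y` the `y`-derivative of this equation is minus the Gram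
matrix of `Dα`, so the implicit function theorem gives a smooth solution `ψ`, and near `Γ` the only
closest point is `α (ψ x)`. Shifting `x` along a normal at `p(x)` keeps the equation true, so `Dp`
kills normals; its values are tangent, and on `Γ` it equals `P_Γ`. Bounding the second derivative of
`p` on a compact neighbourhood gives `‖Dp(x) - P_Γ(p(x))‖ ≤ M ρ(x)` (`exists_tube_bounds`), and `H =
(P_Γ - Dp)/ρ` is an admissible factor.

On a cell, `B = Dp P_{Γ_h}` whatever `H` is, and `Dp - P_Γ = O(h²)`. The gap `P_Γ - P_{Γ_h}` is only
`O(h)` but enters quadratically: `‖v‖² - ‖P_Γ v‖² = ‖v - P_Γ v‖²` for `v` tangent to the cell, and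
`P - PQP = P(P - Q)²P` for projections `P`, `Q`. Hence `BᵀB` has eigenvalues `1 + O(h²)` on the cell
directions, which controls the inverse and the determinant (`cell_estimates`).

The integral statements follow from the area formula on each cell, summed over finitely many cells
that overlap in null sets (`measure_estimates`). -/

open scoped ContDiff ENNReal

noncomputable section

namespace CutFEM

open Topology Filter Module

/-! ### The area formula for injective `C¹` immersions, by local comparison with the derivative. -/

section AreaFormula

variable {V W : Type*} [NormedAddCommGroup V] [InnerProductSpace ℝ V] [FiniteDimensional ℝ V]
  [MeasurableSpace V] [BorelSpace V] [NormedAddCommGroup W] [InnerProductSpace ℝ W]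
  [MeasurableSpace W] [BorelSpace W]

/-- Comparison of Hausdorff measures of two images of a set, one of which is a Lipschitz image of
the other. -/
lemma euclideanHausdorffMeasure_image_le_of_dist_le {X W : Type*} [MetricSpace W]
    [MeasurableSpace W] [BorelSpace W] {f g : X → W} {s : Set X} {t : NNReal} (d : ℕ)
    (hfg : ∀ y ∈ s, ∀ z ∈ s, dist (f y) (f z) ≤ t * dist (g y) (g z)) :
    (Measure.euclideanHausdorffMeasure d : Measure W) (f '' s) ≤
      (t : ℝ≥0∞) ^ d * (Measure.euclideanHausdorffMeasure d : Measure W) (g '' s) := by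
  rcases s.eq_empty_or_nonempty with rfl | ⟨x₀, -⟩
  · simp
  have : Nonempty X := ⟨x₀⟩
  -- `g` need not be injective: by `hfg`, equal values of `g` force equal values of `f`, so `f`
  -- factors through `g` by a `t`-Lipschitz map on `g '' s`.
  let φ : W → W := f ∘ Function.invFunOn g s
  have hinv : ∀ y ∈ s, Function.invFunOn g s (g y) ∈ s ∧ g (Function.invFunOn g s (g y)) = g y :=
    fun y hy => ⟨Function.invFunOn_mem ⟨y, hy, rfl⟩, Function.invFunOn_eq ⟨y, hy, rfl⟩⟩
  have hφ : ∀ y ∈ s, φ (g y) = f y := fun y hy => by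
    have h := hfg _ (hinv y hy).1 y hy
    rw [(hinv y hy).2, dist_self, mul_zero] at h
    exact dist_le_zero.1 h
  have hL : LipschitzOnWith t φ (g '' s) := by
    refine LipschitzOnWith.of_dist_le_mul ?_
    rintro _ ⟨y, hy, rfl⟩ _ ⟨z, hz, rfl⟩
    rw [hφ y hy, hφ z hz]
    exact hfg y hy z hz
  have himg : φ '' (g '' s) = f '' s := by
    rw [image_image]
    exact image_congr hφ
  have h := hL.hausdorffMeasure_image_le (d := d) (Nat.cast_nonneg d)
  rw [himg, ENNReal.rpow_natCast] at h
  simp only [Measure.euclideanHausdorffMeasure_def, Measure.smul_apply, ENNReal.smul_def,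
    smul_eq_mul]
  calc _ ≤ _ := mul_le_mul_right h _
    _ = _ := by ring

/-- `normDet` is the volume scaling factor of a linear map, so it suffices to compare the images of
the unit ball, whose volume is positive and finite and cancels. -/
lemma normDet_le_of_norm_le {A B : V →L[ℝ] W} {t : NNReal} (h : ∀ v, ‖A v‖ ≤ t * ‖B v‖) :
    ENNReal.ofReal (A : V →ₗ[ℝ] W).normDet ≤
      (t : ℝ≥0∞) ^ finrank ℝ V * ENNReal.ofReal (B : V →ₗ[ℝ] W).normDet := by
  have hle := euclideanHausdorffMeasure_image_le_of_dist_le (s := Metric.ball (0 : V) 1)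
    (f := A) (g := B) (t := t) (finrank ℝ V) (fun y _ z _ => by
      rw [dist_eq_norm, dist_eq_norm, ← map_sub, ← map_sub]; exact h _)
  have e := fun C : V →L[ℝ] W => LinearMap.euclideanHausdorffMeasure_image_eq_normDet_mul_volume
    (C : V →ₗ[ℝ] W) (Metric.ball (0 : V) 1)
  simp only [ContinuousLinearMap.coe_coe] at e
  rw [e, e, ← mul_assoc] at hle
  exact (ENNReal.mul_le_mul_iff_left (Metric.measure_ball_pos _ _ one_pos).ne'
    measure_ball_lt_top.ne).1 hle

omit [MeasurableSpace V] [BorelSpace V] [MeasurableSpace W] [BorelSpace W] in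
/-- Near a point where its derivative `A` is injective, a `C¹` map is comparable with `A`, with
constants close to `1`. -/
lemma exists_nhds_bilipschitz_fderiv {f : V → W} {x : V} (hf : ContDiffAt ℝ 1 f x)
    (hinj : (fderiv ℝ f x : V →ₗ[ℝ] W).ker = ⊥) {t : NNReal} (ht : 1 < t) :
    ∃ u : Set V, IsOpen u ∧ x ∈ u ∧
      (∀ y ∈ u, ∀ z ∈ u, dist (f y) (f z) ≤ t * dist (fderiv ℝ f x y) (fderiv ℝ f x z)) ∧
      (∀ y ∈ u, ∀ z ∈ u, dist (fderiv ℝ f x y) (fderiv ℝ f x z) ≤ t * dist (f y) (f z)) ∧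
      (∀ y ∈ u, ∀ v, ‖fderiv ℝ f y v‖ ≤ t * ‖fderiv ℝ f x v‖) ∧
      (∀ y ∈ u, ∀ v, ‖fderiv ℝ f x v‖ ≤ t * ‖fderiv ℝ f y v‖) := by
  set A := fderiv ℝ f x with hA
  obtain ⟨K, hK, hKA⟩ := LinearMap.exists_antilipschitzWith (A : V →ₗ[ℝ] W) hinj
  have hKA' : ∀ v, ‖v‖ ≤ K * ‖A v‖ := fun v => by
    simpa [dist_eq_norm] using hKA.le_mul_dist v 0
  have ht' : (1 : ℝ) < t := by exact_mod_cast ht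
  have ht0 : (0 : ℝ) < t := one_pos.trans ht'
  have hK' : (0 : ℝ) < K := by exact_mod_cast hK
  -- A relative error `η` must cost at most the factor `t` in both directions: `1 + η ≤ t` and `(1 -
  -- η)⁻¹ = t`.
  set η : ℝ := 1 - (t : ℝ)⁻¹ with hη
  have hη0 : 0 < η := sub_pos.2 (inv_lt_one_of_one_lt₀ ht')
  have hη1 : 1 + η ≤ t := by
    have h1 : (t : ℝ) * (t : ℝ)⁻¹ = 1 := mul_inv_cancel₀ ht0.ne'
    have h2 : 0 ≤ ((t : ℝ) - 1) ^ 2 * (t : ℝ)⁻¹ := by positivity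
    nlinarith
  have hη2 : 1 = t * (1 - η) := by
    rw [hη, sub_sub_cancel, mul_inv_cancel₀ ht0.ne']
  have key : ∀ {a b : W} {v : V}, A v = b → ‖a - b‖ ≤ η / K * ‖v‖ →
      ‖a‖ ≤ t * ‖b‖ ∧ ‖b‖ ≤ t * ‖a‖ := by
    intro a b v hb hab
    have h1 : ‖a - b‖ ≤ η * ‖b‖ := by
      calc ‖a - b‖ ≤ η / K * ‖v‖ := hab
        _ ≤ η / K * (K * ‖b‖) := by
          gcongr
          rw [← hb]
          exact hKA' v
        _ = η * ‖b‖ := by field_simp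
    have h2 := norm_sub_norm_le a b
    have h3 := norm_sub_norm_le b a
    rw [norm_sub_rev] at h3
    constructor
    · nlinarith [norm_nonneg b]
    · have : (1 - η) * ‖b‖ ≤ ‖a‖ := by linarith
      calc ‖b‖ = t * ((1 - η) * ‖b‖) := by rw [← mul_assoc, ← hη2, one_mul]
        _ ≤ _ := by gcongr
  have hc : (0 : ℝ) < η / K := by positivity
  obtain ⟨s, hs, hsA⟩ := (hf.hasStrictFDerivAt one_ne_zero).approximates_deriv_on_nhds
    (c := ⟨η / K, hc.le⟩) (Or.inr hc)
  have hcont : ContinuousAt (fderiv ℝ f) x := (hf.fderiv_right (m := 0) (by simp)).continuousAt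
  have hball : ∀ᶠ y in 𝓝 x, ‖fderiv ℝ f y - A‖ < η / K := by
    have := hcont (Metric.ball_mem_nhds _ hc)
    filter_upwards [this] with y hy
    simpa [dist_eq_norm] using hy
  obtain ⟨u, hu, huo, hxu⟩ := mem_nhds_iff.1 (inter_mem hs hball)
  refine ⟨u, huo, hxu, ?_⟩
  have h1 : ∀ y ∈ u, ∀ z ∈ u, ‖f y - f z‖ ≤ t * ‖A y - A z‖ ∧ ‖A y - A z‖ ≤ t * ‖f y - f z‖ :=
    fun y hy z hz => key (map_sub A y z) (by
      rw [← map_sub]; exact hsA _ (hu hy).1 _ (hu hz).1)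
  have h2 : ∀ y ∈ u, ∀ v, ‖fderiv ℝ f y v‖ ≤ t * ‖A v‖ ∧ ‖A v‖ ≤ t * ‖fderiv ℝ f y v‖ :=
    fun y hy v => key rfl (by
      rw [← _root_.sub_apply]
      exact (ContinuousLinearMap.le_opNorm _ _).trans
        (mul_le_mul_of_nonneg_right (hu hy).2.le (norm_nonneg _)))
  simp only [dist_eq_norm]
  exact ⟨fun y hy z hz => (h1 y hy z hz).1, fun y hy z hz => (h1 y hy z hz).2,
    fun y hy v => (h2 y hy v).1, fun y hy v => (h2 y hy v).2⟩

/-- Both quantities are compared with the measure of `A '' s`, where `A` is the derivative at `x`.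
One factor `t ^ d` is the cost of replacing `f` by `A`, another that of replacing the derivative at
`y` by `A`; hence the exponent `2 * d`. -/
lemma exists_nhds_image_measure_compare {f : V → W} {x : V} (hf : ContDiffAt ℝ 1 f x)
    (hinj : (fderiv ℝ f x : V →ₗ[ℝ] W).ker = ⊥) {t : NNReal} (ht : 1 < t) :
    ∃ u : Set V, IsOpen u ∧ x ∈ u ∧ ∀ s ⊆ u, MeasurableSet s →
      (Measure.euclideanHausdorffMeasure (finrank ℝ V) : Measure W) (f '' s) ≤
        (t : ℝ≥0∞) ^ (2 * finrank ℝ V) *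
          ∫⁻ y in s, ENNReal.ofReal (fderiv ℝ f y : V →ₗ[ℝ] W).normDet ∧
      ∫⁻ y in s, ENNReal.ofReal (fderiv ℝ f y : V →ₗ[ℝ] W).normDet ≤
        (t : ℝ≥0∞) ^ (2 * finrank ℝ V) *
          (Measure.euclideanHausdorffMeasure (finrank ℝ V) : Measure W) (f '' s) := by
  obtain ⟨u, huo, hxu, h1, h2, h3, h4⟩ := exists_nhds_bilipschitz_fderiv hf hinj ht
  refine ⟨u, huo, hxu, fun s hsu hs => ?_⟩
  set A := fderiv ℝ f x with hA
  set d := finrank ℝ V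
  have e := LinearMap.euclideanHausdorffMeasure_image_eq_normDet_mul_volume (A : V →ₗ[ℝ] W) s
  simp only [ContinuousLinearMap.coe_coe] at e
  have htop : ((t : ℝ≥0∞) ^ d) ≠ ⊤ := by simp
  have hpow : (t : ℝ≥0∞) ^ (2 * d) = (t : ℝ≥0∞) ^ d * (t : ℝ≥0∞) ^ d := by ring
  constructor
  · refine (euclideanHausdorffMeasure_image_le_of_dist_le d
      fun y hy z hz => h1 y (hsu hy) z (hsu hz)).trans ?_
    rw [e, hpow, mul_assoc]
    refine mul_le_mul_right ?_ _
    rw [← setLIntegral_const, ← lintegral_const_mul' _ _ htop]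
    exact setLIntegral_mono' hs fun y hy => normDet_le_of_norm_le (h4 y (hsu hy))
  · calc _ ≤ ∫⁻ y in s, (t : ℝ≥0∞) ^ d * ENNReal.ofReal (A : V →ₗ[ℝ] W).normDet :=
        setLIntegral_mono' hs fun y hy => normDet_le_of_norm_le (h3 y (hsu hy))
      _ = (t : ℝ≥0∞) ^ d * (Measure.euclideanHausdorffMeasure d : Measure W) (A '' s) := by
        rw [setLIntegral_const, e, mul_assoc]
      _ ≤ _ := by
        rw [hpow, mul_assoc]
        exact mul_le_mul_right (euclideanHausdorffMeasure_image_le_of_dist_le d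
          fun y hy z hz => h2 y (hsu hy) z (hsu hz)) _

/-- The area formula for an injective `C¹` immersion. -/
theorem euclideanHausdorffMeasure_image_eq_lintegral_normDet_fderiv {f : V → W} {s : Set V}
    (hs : MeasurableSet s) (hf : ∀ x ∈ s, ContDiffAt ℝ 1 f x)
    (hker : ∀ x ∈ s, (fderiv ℝ f x : V →ₗ[ℝ] W).ker = ⊥) (hinj : InjOn f s) :
    (Measure.euclideanHausdorffMeasure (finrank ℝ V) : Measure W) (f '' s) =
      ∫⁻ y in s, ENNReal.ofReal (fderiv ℝ f y : V →ₗ[ℝ] W).normDet := by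
  set d := finrank ℝ V
  have hcont : ContinuousOn f s := fun x hx => (hf x hx).continuousAt.continuousWithinAt
  have main : ∀ t : NNReal, 1 < t →
      (Measure.euclideanHausdorffMeasure d : Measure W) (f '' s) ≤
        (t : ℝ≥0∞) ^ (2 * d) * ∫⁻ y in s, ENNReal.ofReal (fderiv ℝ f y : V →ₗ[ℝ] W).normDet ∧
      ∫⁻ y in s, ENNReal.ofReal (fderiv ℝ f y : V →ₗ[ℝ] W).normDet ≤
        (t : ℝ≥0∞) ^ (2 * d) *
          (Measure.euclideanHausdorffMeasure d : Measure W) (f '' s) := by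
    intro t ht
    rcases s.eq_empty_or_nonempty with rfl | hne
    · simp
    choose! u huo hxu hu using fun x (hx : x ∈ s) =>
      exists_nhds_image_measure_compare (hf x hx) (hker x hx) ht
    obtain ⟨T, hTs, hTc, hT⟩ := TopologicalSpace.countable_cover_nhdsWithin
      (f := u) (s := s) fun x hx => mem_nhdsWithin_of_mem_nhds ((huo x hx).mem_nhds (hxu x hx))
    have hTne : T.Nonempty := by
      rcases T.eq_empty_or_nonempty with rfl | h
      · obtain ⟨x, hx⟩ := hne
        simpa using hT hx
      · exact h
    obtain ⟨c, rfl⟩ := hTc.exists_eq_range hTne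
    have hc : ∀ n, c n ∈ s := fun n => hTs (mem_range_self n)
    -- Disjoint pieces, each inside one good neighbourhood. Both sides are additive over them, the
    -- left one because `f` is injective, so the local estimates sum with the same constant.
    let w : ℕ → Set V := fun n => s ∩ disjointed (fun n => u (c n)) n
    have hwm : ∀ n, MeasurableSet (w n) := fun n =>
      hs.inter (MeasurableSet.disjointed (fun n => (huo _ (hc n)).measurableSet) n)
    have hwd : Pairwise (Function.onFun Disjoint w) := fun i j hij =>
      (disjoint_disjointed (fun n => u (c n)) hij).mono inter_subset_right inter_subset_right
    have hws : ⋃ n, w n = s := by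
      rw [← inter_iUnion, iUnion_disjointed, inter_eq_left]
      simpa using hT
    have hwu : ∀ n, w n ⊆ u (c n) := fun n => inter_subset_right.trans (disjointed_le _ n)
    have hsum : (Measure.euclideanHausdorffMeasure d : Measure W) (f '' s) =
        ∑' n, (Measure.euclideanHausdorffMeasure d : Measure W) (f '' w n) := by
      conv_lhs => rw [← hws, image_iUnion]
      refine measure_iUnion (fun i j hij => ?_) fun n => ?_
      · have := hinj.image_inter (inter_subset_left : w i ⊆ s) (inter_subset_left : w j ⊆ s)
        rw [(hwd hij).inter_eq, image_empty] at this
        exact disjoint_iff_inter_eq_empty.2 this.symm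
      · exact (hwm n).image_of_continuousOn_injOn (hcont.mono inter_subset_left)
          (hinj.mono inter_subset_left)
    have hint : ∫⁻ y in s, ENNReal.ofReal (fderiv ℝ f y : V →ₗ[ℝ] W).normDet =
        ∑' n, ∫⁻ y in w n, ENNReal.ofReal (fderiv ℝ f y : V →ₗ[ℝ] W).normDet := by
      conv_lhs => rw [← hws]
      exact lintegral_iUnion hwm hwd _
    rw [hsum, hint, ← ENNReal.tsum_mul_left, ← ENNReal.tsum_mul_left]
    exact ⟨ENNReal.tsum_le_tsum fun n => (hu _ (hc n) (w n) (hwu n) (hwm n)).1,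
      ENNReal.tsum_le_tsum fun n => (hu _ (hc n) (w n) (hwu n) (hwm n)).2⟩
  -- The factor `t ^ (2 * d)` no longer depends on the cover, so `t` may decrease to `1`.
  have lim : ∀ a b : ℝ≥0∞, (∀ t : NNReal, 1 < t → a ≤ (t : ℝ≥0∞) ^ (2 * d) * b) → a ≤ b := by
    intro a b h
    have h1 : Tendsto (fun t : NNReal => (t : ℝ≥0∞) ^ (2 * d) * b) (𝓝[>] 1) (𝓝 (1 * b)) := by
      refine ENNReal.Tendsto.mul_const ?_ (Or.inl one_ne_zero)
      have h2 : Continuous fun t : NNReal => ((t ^ (2 * d) : NNReal) : ℝ≥0∞) := by fun_prop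
      have h3 := (h2.tendsto 1).mono_left (nhdsWithin_le_nhds (s := Ioi 1))
      simpa using h3
    rw [one_mul] at h1
    exact ge_of_tendsto h1 (by filter_upwards [self_mem_nhdsWithin] with t ht using h t ht)
  exact le_antisymm (lim _ _ fun t ht => (main t ht).1) (lim _ _ fun t ht => (main t ht).2)

/-- The area formula on a subset of an affine subspace. -/
theorem euclideanHausdorffMeasure_image_eq_setLIntegral_normDet {E : Type*} [NormedAddCommGroup E]
    [InnerProductSpace ℝ E] [MeasurableSpace E] [BorelSpace E] {V₀ : Submodule ℝ E}
    [FiniteDimensional ℝ V₀] {x₀ : E} {f : E → W} {S : Set E} (hS : MeasurableSet S)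
    (hSV : ∀ x ∈ S, x - x₀ ∈ V₀) (hf : ∀ x ∈ S, ContDiffAt ℝ 1 f x)
    (hker : ∀ x ∈ S, ((fderiv ℝ f x ∘L V₀.subtypeL : V₀ →L[ℝ] W) : V₀ →ₗ[ℝ] W).ker = ⊥)
    (hinj : InjOn f S) :
    (Measure.euclideanHausdorffMeasure (finrank ℝ V₀) : Measure W) (f '' S) =
      ∫⁻ x in S, ENNReal.ofReal
        ((fderiv ℝ f x ∘L V₀.subtypeL : V₀ →L[ℝ] W) : V₀ →ₗ[ℝ] W).normDet
          ∂(Measure.euclideanHausdorffMeasure (finrank ℝ V₀)) := by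
  -- An isometry from `V₀` onto the affine subspace, which carries Lebesgue measure to Hausdorff
  -- measure.
  let ι : V₀ → E := fun v => (v : E) + x₀
  have hι : Isometry ι := (IsometryEquiv.addRight x₀).isometry.comp isometry_subtype_coe
  have hιm : MeasurableEmbedding ι := hι.isClosedEmbedding.measurableEmbedding
  have himg : ι '' (ι ⁻¹' S) = S :=
    image_preimage_eq_of_subset fun x hx => ⟨⟨x - x₀, hSV x hx⟩, by simp [ι]⟩
  have hd : ∀ v ∈ ι ⁻¹' S, HasFDerivAt (f ∘ ι) (fderiv ℝ f (ι v) ∘L V₀.subtypeL) v := fun v hv =>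
    ((hf _ hv).differentiableAt one_ne_zero).hasFDerivAt.comp v
      (V₀.subtypeL.hasFDerivAt.add_const x₀)
  have hcd : ContDiff ℝ 1 ι := V₀.subtypeL.contDiff.add contDiff_const
  have hA := euclideanHausdorffMeasure_image_eq_lintegral_normDet_fderiv (f := f ∘ ι)
    (hιm.measurable hS) (fun v hv => (hf _ hv).comp v hcd.contDiffAt)
    (fun v hv => by rw [(hd v hv).fderiv]; exact hker _ hv)
    (hinj.comp hι.injective.injOn (mapsTo_preimage ι S))
  rw [image_comp, himg] at hA
  have hμ : (Measure.euclideanHausdorffMeasure (finrank ℝ V₀) : Measure E).restrict S =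
      (Measure.map ι volume).restrict S := by
    rw [← InnerProductSpace.euclideanHausdorffMeasure_eq_volume, hι.map_euclideanHausdorffMeasure,
      Measure.restrict_restrict hS, inter_eq_left.2]
    rw [← himg]
    exact image_subset_range _ _
  rw [hA, hμ, hιm.restrict_map, hιm.lintegral_map]
  exact setLIntegral_congr_fun (hιm.measurable hS) fun v hv => by rw [(hd v hv).fderiv]

end AreaFormula

/-! ### Determinants of nearly isometric linear maps. -/

lemma absDet_eq_normDet {V W : Type*} [NormedAddCommGroup V] [InnerProductSpace ℝ V]
    [FiniteDimensional ℝ V] [NormedAddCommGroup W] [InnerProductSpace ℝ W] [FiniteDimensional ℝ W]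
    (A : V →L[ℝ] W) : absDet A = (A : V →ₗ[ℝ] W).normDet := by
  rw [absDet, ← LinearMap.normDet_sq]
  exact Real.sqrt_sq (LinearMap.normDet_nonneg _)

/-- If `A` distorts squared lengths by a factor in `[1 - ε, 1 + ε]`, its determinant is close to
`1`. -/
lemma abs_one_sub_absDet_le {V W : Type*} [NormedAddCommGroup V] [InnerProductSpace ℝ V]
    [FiniteDimensional ℝ V] [NormedAddCommGroup W] [InnerProductSpace ℝ W] [FiniteDimensional ℝ W]
    (A : V →L[ℝ] W) {ε : ℝ} (hε0 : 0 ≤ ε) (hε1 : ε ≤ 1)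
    (h : ∀ v, |‖A v‖ ^ 2 - ‖v‖ ^ 2| ≤ ε * ‖v‖ ^ 2) :
    |1 - absDet A| ≤ finrank ℝ V * 2 ^ finrank ℝ V * ε := by
  set n := finrank ℝ V with hn
  set T : V →ₗ[ℝ] V := LinearMap.adjoint (A : V →ₗ[ℝ] W) ∘ₗ (A : V →ₗ[ℝ] W) with hT
  have hTs : T.IsSymmetric := fun x y => by
    simp only [hT, LinearMap.comp_apply, LinearMap.adjoint_inner_left,
      LinearMap.adjoint_inner_right]
  have hdet := hTs.det_eq_prod_eigenvalues hn.symm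
  -- For a unit eigenvector `v` of `A*A`, the eigenvalue is `‖A v‖²`.
  have hev : ∀ i, |hTs.eigenvalues hn.symm i - 1| ≤ ε := fun i => by
    set v := hTs.eigenvectorBasis hn.symm i with hv
    have hv1 : ‖v‖ = 1 := (hTs.eigenvectorBasis hn.symm).orthonormal.1 i
    have h1 : T v = hTs.eigenvalues hn.symm i • v := hTs.apply_eigenvectorBasis hn.symm i
    have h2 : ‖A v‖ ^ 2 = hTs.eigenvalues hn.symm i := by
      have h3 : inner ℝ (T v) v = ‖A v‖ ^ 2 := by
        rw [hT, LinearMap.comp_apply, LinearMap.adjoint_inner_left]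
        exact real_inner_self_eq_norm_sq _
      rw [← h3, h1, inner_smul_left, real_inner_self_eq_norm_sq, hv1]
      simp
    have := h v
    rwa [h2, hv1, one_pow, mul_one] at this
  -- Since `ε ≤ 1`, every eigenvalue is at most `2` in absolute value: a further factor at most
  -- doubles the accumulated error and adds at most `ε`.
  have hprod : ∀ s : Finset (Fin n), |∏ i ∈ s, hTs.eigenvalues hn.symm i - 1| ≤
      s.card * 2 ^ s.card * ε := by
    intro s
    induction s using Finset.induction_on with
    | empty => simp
    | insert a s has ih =>
      rw [Finset.prod_insert has, Finset.card_insert_of_notMem has]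
      set P := ∏ i ∈ s, hTs.eigenvalues hn.symm i
      set e := hTs.eigenvalues hn.symm a
      have he := hev a
      have he2 : |e| ≤ 2 := by
        have := abs_sub_abs_le_abs_sub e 1
        rw [abs_one] at this
        linarith
      have h1 : |e * P - 1| ≤ |e| * |P - 1| + |e - 1| := by
        rw [← abs_mul]
        refine le_trans (le_of_eq ?_) (abs_add_le _ _)
        ring_nf
      have h2 : (1 : ℝ) ≤ 2 ^ (s.card + 1) := one_le_pow₀ (by norm_num)
      calc |e * P - 1| ≤ |e| * |P - 1| + |e - 1| := h1
        _ ≤ 2 * (s.card * 2 ^ s.card * ε) + 2 ^ (s.card + 1) * ε := by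
          gcongr
          exact he.trans (le_mul_of_one_le_left hε0 h2)
        _ = _ := by push_cast; ring
  have hD := hprod Finset.univ
  rw [Finset.card_univ, Fintype.card_fin] at hD
  have hdet' : absDet A ^ 2 = ∏ i, hTs.eigenvalues hn.symm i := by
    rw [absDet_eq_normDet]
    exact (LinearMap.normDet_sq (A : V →ₗ[ℝ] W)).trans hdet
  have hnn : 0 ≤ absDet A := Real.sqrt_nonneg _
  -- The bound for `absDet A ^ 2` passes to `absDet A` because `1 + absDet A ≥ 1`.
  calc |1 - absDet A| ≤ |1 - absDet A| * |1 + absDet A| :=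
        le_mul_of_one_le_right (abs_nonneg _) (by rw [abs_of_nonneg] <;> linarith)
    _ = |absDet A ^ 2 - 1| := by rw [← abs_mul, abs_sub_comm]; ring_nf
    _ ≤ _ := by rw [hdet']; exact hD

/-! ### Closest points in local coordinates, by the implicit function theorem. -/

/-- The implicit function theorem for a smooth equation, with a solution that is smooth on a
neighbourhood. -/
lemma exists_smooth_implicitFunction {E₁ E₂ F : Type*} [NormedAddCommGroup E₁] [NormedSpace ℝ E₁]
    [CompleteSpace E₁] [NormedAddCommGroup E₂] [NormedSpace ℝ E₂] [CompleteSpace E₂]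
    [NormedAddCommGroup F] [NormedSpace ℝ F] [CompleteSpace F] {f : E₁ × E₂ → F} {u₀ : E₁ × E₂}
    {O : Set (E₁ × E₂)} (hO : O ∈ 𝓝 u₀) (hf : ∀ u ∈ O, ContDiffAt ℝ ∞ f u)
    (hinv : (fderiv ℝ f u₀ ∘L .inr ℝ E₁ E₂).IsInvertible) :
    ∃ ψ : E₁ → E₂, ψ u₀.1 = u₀.2 ∧ (∀ᶠ x in 𝓝 u₀.1, ContDiffAt ℝ ∞ ψ x) ∧
      ∀ᶠ v in 𝓝 u₀, f v = f u₀ ↔ ψ v.1 = v.2 := by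
  have cdf := hf u₀ (mem_of_mem_nhds hO)
  have hn : (∞ : WithTop ℕ∞) ≠ 0 := by simp
  let ψ := cdf.implicitFunction hn hinv
  have hψ₀ : ψ u₀.1 = u₀.2 := cdf.implicitFunction_apply_self hn hinv
  have hψc : ContDiffAt ℝ ∞ ψ u₀.1 := cdf.contDiffAt_implicitFunction hn hinv
  -- `C^∞` at one point yields each finite order only on a neighbourhood depending on that order.
  -- Order one provides continuity of `ψ` nearby; full smoothness there is recovered below.
  have hψe : ∀ᶠ x in 𝓝 u₀.1, ContinuousAt ψ x :=
    ((hψc.of_le (m := 1) (by simp)).eventually (by simp)).mono fun x hx => hx.continuousAt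
  have hgraph : Tendsto (fun x => (x, ψ x)) (𝓝 u₀.1) (𝓝 u₀) := by
    have h : ContinuousAt (fun x => (x, ψ x)) u₀.1 := continuousAt_id.prodMk hψc.continuousAt
    have h' := h.tendsto
    rwa [hψ₀] at h'
  have hcont : ContinuousAt (fun u => fderiv ℝ f u ∘L .inr ℝ E₁ E₂) u₀ :=
    ((cdf.fderiv_right (m := 0) (by simp)).continuousAt).clm_comp continuousAt_const
  have hinv' : ∀ᶠ u in 𝓝 u₀, (fderiv ℝ f u ∘L .inr ℝ E₁ E₂).IsInvertible := by
    obtain ⟨e, he⟩ := hinv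
    have := e.nhds
    rw [he] at this
    exact hcont this
  refine ⟨ψ, hψ₀, ?_, cdf.eventually_apply_eq_iff_implicitFunction hn hinv⟩
  have hsol : ∀ᶠ x in 𝓝 u₀.1, f (x, ψ x) = f u₀ := cdf.eventually_apply_implicitFunction hn hinv
  filter_upwards [hψe, hgraph hO, hgraph.eventually hinv', hsol.eventually_nhds]
    with x hxc hxO hxi hxs
  have cdx := hf _ hxO
  have hiff := cdx.eventually_apply_eq_iff_implicitFunction hn hxi
  have hg : Tendsto (fun x' => (x', ψ x')) (𝓝 x) (𝓝 (x, ψ x)) :=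
    (continuousAt_id.prodMk hxc : ContinuousAt (fun x => (x, ψ x)) x)
  -- Local uniqueness identifies `ψ` near `x` with the implicit function based at `(x, ψ x)`, which
  -- is smooth at `x`.
  have heq : ψ =ᶠ[𝓝 x] cdx.implicitFunction hn hxi := by
    filter_upwards [hg.eventually hiff, hxs] with x' h1 h2
    exact (h1.1 (h2.trans hxs.self_of_nhds.symm)).symm
  exact (cdx.contDiffAt_implicitFunction hn hxi).congr_of_eventuallyEq heq

/-- `α : V → Γ ∩ U` is a smooth local parametrization of `Γ` with continuous inverse `β`. -/
structure IsChart {k : ℕ} (d : ℕ) (Γ U : Set (Amb k)) (V : Set (EuclideanSpace ℝ (Fin d)))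
    (α : EuclideanSpace ℝ (Fin d) → Amb k) (β : Amb k → EuclideanSpace ℝ (Fin d)) : Prop where
  isOpen_target : IsOpen U
  isOpen_source : IsOpen V
  image_eq : α '' V = Γ ∩ U
  contDiffOn : ContDiffOn ℝ ∞ α V
  injective_fderiv : ∀ y ∈ V, Function.Injective (fderiv ℝ α y)
  continuousOn_inv : ContinuousOn β (Γ ∩ U)
  leftInvOn : LeftInvOn β α V

/-- The derivative of `y ↦ ‖x - α y‖² / 2`, up to sign, in coordinates. -/
def critEq {k d : ℕ} (α : EuclideanSpace ℝ (Fin d) → Amb k)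
    (u : Amb k × EuclideanSpace ℝ (Fin d)) : EuclideanSpace ℝ (Fin d) :=
  WithLp.toLp 2 fun i => inner ℝ (u.1 - α u.2) (fderiv ℝ α u.2 (EuclideanSpace.single i 1))

lemma critEq_eq_zero_iff {k d : ℕ} {α : EuclideanSpace ℝ (Fin d) → Amb k}
    {u : Amb k × EuclideanSpace ℝ (Fin d)} :
    critEq α u = 0 ↔ ∀ w, inner ℝ (u.1 - α u.2) (fderiv ℝ α u.2 w) = 0 := by
  constructor
  · intro h w
    have h' : ∀ i, inner ℝ (u.1 - α u.2) (fderiv ℝ α u.2 (EuclideanSpace.single i 1)) = 0 :=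
      fun i => congrArg (fun z : EuclideanSpace ℝ (Fin d) => z i) h
    rw [← (EuclideanSpace.basisFun (Fin d) ℝ).sum_repr w]
    simp [inner_sum, inner_smul_right, h']
  · intro h
    ext i
    exact h _

namespace IsChart

variable {k d : ℕ} {Γ U : Set (Amb k)} {V : Set (EuclideanSpace ℝ (Fin d))}
  {α : EuclideanSpace ℝ (Fin d) → Amb k} {β : Amb k → EuclideanSpace ℝ (Fin d)}

lemma contDiffAt (hα : IsChart d Γ U V α β) {y : EuclideanSpace ℝ (Fin d)} (hy : y ∈ V) :
    ContDiffAt ℝ ∞ α y :=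
  hα.contDiffOn.contDiffAt (hα.isOpen_source.mem_nhds hy)

lemma hasFDerivAt (hα : IsChart d Γ U V α β) {y : EuclideanSpace ℝ (Fin d)} (hy : y ∈ V) :
    HasFDerivAt α (fderiv ℝ α y) y :=
  ((hα.contDiffAt hy).differentiableAt (by simp)).hasFDerivAt

lemma mem (hα : IsChart d Γ U V α β) {y : EuclideanSpace ℝ (Fin d)} (hy : y ∈ V) : α y ∈ Γ ∩ U :=
  hα.image_eq ▸ mem_image_of_mem α hy

lemma inv_mem (hα : IsChart d Γ U V α β) {q : Amb k} (hq : q ∈ Γ ∩ U) : β q ∈ V ∧ α (β q) = q := by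
  rw [← hα.image_eq] at hq
  obtain ⟨y, hy, rfl⟩ := hq
  rw [hα.leftInvOn hy]
  exact ⟨hy, rfl⟩

lemma contDiffAt_critEq (hα : IsChart d Γ U V α β) {u : Amb k × EuclideanSpace ℝ (Fin d)}
    (hu : u.2 ∈ V) : ContDiffAt ℝ ∞ (critEq α) u := by
  have h1 : ContDiffAt ℝ ∞ (fun u : Amb k × EuclideanSpace ℝ (Fin d) => α u.2) u :=
    (hα.contDiffAt hu).comp u contDiffAt_snd
  have h2 : ContDiffAt ℝ ∞ (fun u : Amb k × EuclideanSpace ℝ (Fin d) => fderiv ℝ α u.2) u :=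
    ((hα.contDiffAt hu).fderiv_right (m := ∞) (by simp)).comp u contDiffAt_snd
  rw [contDiffAt_euclidean]
  exact fun i => (contDiffAt_fst.sub h1).inner ℝ (h2.clm_apply contDiffAt_const)

/-- At a point of `Γ` the critical point equation is nondegenerate. -/
lemma isInvertible_fderiv_critEq (hα : IsChart d Γ U V α β) {y : EuclideanSpace ℝ (Fin d)}
    (hy : y ∈ V) : (fderiv ℝ (critEq α) (α y, y) ∘L .inr ℝ _ _).IsInvertible := by
  have hG : HasFDerivAt (critEq α) (fderiv ℝ (critEq α) (α y, y)) (α y, y) :=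
    ((hα.contDiffAt_critEq hy).differentiableAt (by simp)).hasFDerivAt
  have hpart : HasFDerivAt (fun z => critEq α (α y, z))
      (fderiv ℝ (critEq α) (α y, y) ∘L .inr ℝ _ _) y :=
    hG.comp y (hasFDerivAt_prodMk_right (α y) y)
  set L := fderiv ℝ (critEq α) (α y, y) ∘L .inr ℝ (Amb k) (EuclideanSpace ℝ (Fin d)) with hL
  -- The term with the second derivative of `α` is paired with `x - α y`, which vanishes at `x = α
  -- y`; what remains is minus the Gram form of `Dα`.
  have hcoord : ∀ w i, L w i =
      - inner ℝ (fderiv ℝ α y w) (fderiv ℝ α y (EuclideanSpace.single i 1)) := by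
    intro w i
    have h1 : HasFDerivAt (fun z => critEq α (α y, z) i) (EuclideanSpace.proj i ∘L L) y :=
      (EuclideanSpace.proj (𝕜 := ℝ) i : EuclideanSpace ℝ (Fin d) →L[ℝ] ℝ).hasFDerivAt.comp y hpart
    have hd2 : DifferentiableAt ℝ (fun z => fderiv ℝ α z (EuclideanSpace.single i 1)) y :=
      ((((hα.contDiffAt hy).fderiv_right (m := ∞) (by simp)).differentiableAt
        (by simp)).clm_apply (differentiableAt_const _))
    have h2 := ((hα.hasFDerivAt hy).const_sub (α y)).inner ℝ hd2.hasFDerivAt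
    have h3 := congrArg (fun M => M w) (h1.unique h2)
    simpa [inner_neg_left] using h3
  have hinj : Function.Injective L := by
    rw [injective_iff_map_eq_zero]
    intro w hw
    have h1 : ∀ i, inner ℝ (fderiv ℝ α y w) (fderiv ℝ α y (EuclideanSpace.single i 1)) = 0 := by
      intro i
      have := hcoord w i
      rw [hw] at this
      simpa using this.symm
    have h2 : inner ℝ (fderiv ℝ α y w) (fderiv ℝ α y w) = 0 := by
      conv_lhs => rw [← (EuclideanSpace.basisFun (Fin d) ℝ).sum_repr w]
      simp only [map_sum, map_smul, EuclideanSpace.basisFun_apply]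
      rw [inner_sum]
      refine Finset.sum_eq_zero fun i _ => ?_
      have h3 := h1 i
      rw [← (EuclideanSpace.basisFun (Fin d) ℝ).sum_repr w] at h3
      simp only [map_sum, map_smul, EuclideanSpace.basisFun_apply] at h3
      rw [inner_smul_right, h3, mul_zero]
    exact hα.injective_fderiv y hy ((inner_self_eq_zero.1 h2).trans (map_zero _).symm)
  exact ⟨(LinearEquiv.ofInjectiveEndo (L : EuclideanSpace ℝ (Fin d) →ₗ[ℝ] _)
    hinj).toContinuousLinearEquiv, by ext; rfl⟩

/-- A closest point solves the critical point equation. -/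
lemma critEq_eq_zero_of_dist_eq (hα : IsChart d Γ U V α β) {x : Amb k}
    {y : EuclideanSpace ℝ (Fin d)} (hy : y ∈ V) (hxy : dist x (α y) = Metric.infDist x Γ) :
    critEq α (x, y) = 0 := by
  rw [critEq_eq_zero_iff]
  intro w
  have hmin : IsLocalMin (fun z => ‖x - α z‖ ^ 2) y := by
    filter_upwards [hα.isOpen_source.mem_nhds hy] with z hz
    rw [← dist_eq_norm, ← dist_eq_norm, hxy]
    exact pow_le_pow_left₀ Metric.infDist_nonneg (Metric.infDist_le_dist_of_mem (hα.mem hz).1) 2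
  have hd := ((hα.hasFDerivAt hy).const_sub x).norm_sq
  have h := congrArg (fun M => M w) (hmin.hasFDerivAt_eq_zero hd)
  simp only [inner_sub_left] at h ⊢
  simp at h
  linarith

/-- Near a point of `Γ`, the closest points have coordinates near those of that point. -/
lemma eventually_closest (hα : IsChart d Γ U V α β) {y₀ : EuclideanSpace ℝ (Fin d)}
    (hy₀ : y₀ ∈ V) {N : Set (Amb k × EuclideanSpace ℝ (Fin d))} (hN : N ∈ 𝓝 (α y₀, y₀)) :
    ∀ᶠ x in 𝓝 (α y₀), ∀ q ∈ Γ, dist x q = Metric.infDist x Γ → q ∈ U ∧ (x, β q) ∈ N := by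
  obtain ⟨hΓ, hU⟩ := hα.mem hy₀
  rw [nhds_prod_eq, mem_prod_iff] at hN
  obtain ⟨N₁, hN₁, N₂, hN₂, hN⟩ := hN
  have hβ := hα.continuousOn_inv _ (hα.mem hy₀)
  rw [ContinuousWithinAt, hα.leftInvOn hy₀] at hβ
  have h1 := hβ hN₂
  have h2 : β ⁻¹' N₂ ∩ U ∈ 𝓝[Γ] (α y₀) := by
    rw [nhdsWithin_inter_of_mem' (mem_nhdsWithin_of_mem_nhds (hα.isOpen_target.mem_nhds hU))] at h1
    exact inter_mem h1 (mem_nhdsWithin_of_mem_nhds (hα.isOpen_target.mem_nhds hU))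
  obtain ⟨ε, hε, hball⟩ := Metric.mem_nhdsWithin_iff.1 h2
  filter_upwards [hN₁, Metric.ball_mem_nhds (α y₀) (half_pos hε)] with x hx1 hx2 q hq hxq
  -- A closest point `q` to `x` is at most twice as far from `α y₀` as `x` is, hence the radius `ε /
  -- 2` for `x`.
  have hdist : dist q (α y₀) < ε := by
    have h3 : dist x q ≤ dist x (α y₀) := hxq.le.trans (Metric.infDist_le_dist_of_mem hΓ)
    have h4 := dist_triangle q x (α y₀)
    rw [dist_comm q x] at h4
    rw [Metric.mem_ball] at hx2
    linarith
  have h5 := hball ⟨hdist, hq⟩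
  exact ⟨h5.2, hN ⟨hx1, h5.1⟩⟩

end IsChart

lemma closestPoint_spec {k : ℕ} {Γ : Set (Amb k)} (hΓ : Γ.Nonempty) (hcpt : IsCompact Γ)
    (x : Amb k) : closestPoint Γ x ∈ Γ ∧ dist x (closestPoint Γ x) = Metric.infDist x Γ := by
  have h : ∃ q ∈ Γ, dist x q = Metric.infDist x Γ := by
    obtain ⟨q, hq, h⟩ := hcpt.exists_infDist_eq_dist hΓ x
    exact ⟨q, hq, h.symm⟩
  rw [closestPoint, dif_pos h]
  exact h.choose_spec

lemma closestPoint_of_mem {k : ℕ} {Γ : Set (Amb k)} (hcpt : IsCompact Γ) {q : Amb k} (hq : q ∈ Γ) :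
    closestPoint Γ q = q := by
  have h := (closestPoint_spec ⟨q, hq⟩ hcpt q).2
  rw [Metric.infDist_zero_of_mem hq] at h
  exact (dist_eq_zero.1 h).symm

namespace IsChart

variable {k d : ℕ} {Γ U : Set (Amb k)} {V : Set (EuclideanSpace ℝ (Fin d))}
  {α : EuclideanSpace ℝ (Fin d) → Amb k} {β : Amb k → EuclideanSpace ℝ (Fin d)}

/-- Near a point of `Γ`, the closest point has smooth coordinates, which are locally constant in
the normal directions. -/
lemma exists_closest_coordinates (hα : IsChart d Γ U V α β) {y₀ : EuclideanSpace ℝ (Fin d)}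
    (hy₀ : y₀ ∈ V) :
    ∃ ψ : Amb k → EuclideanSpace ℝ (Fin d), ψ (α y₀) = y₀ ∧ ∀ᶠ x in 𝓝 (α y₀),
      ψ x ∈ V ∧ ContDiffAt ℝ ∞ ψ x ∧
      (∀ q ∈ Γ, dist x q = Metric.infDist x Γ → q = α (ψ x)) ∧
      (∀ ν, (∀ w, inner ℝ ν (fderiv ℝ α (ψ x) w) = 0) →
        ∀ᶠ t : ℝ in 𝓝 0, ψ (x + t • ν) = ψ x) := by
  have hO : {u : Amb k × EuclideanSpace ℝ (Fin d) | u.2 ∈ V} ∈ 𝓝 (α y₀, y₀) :=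
    continuous_snd.continuousAt (hα.isOpen_source.mem_nhds hy₀)
  obtain ⟨ψ, hψ₀, hψ, hiff⟩ := exists_smooth_implicitFunction hO
    (fun u hu => hα.contDiffAt_critEq hu) (hα.isInvertible_fderiv_critEq hy₀)
  have h0 : critEq α (α y₀, y₀) = 0 := critEq_eq_zero_iff.2 fun w => by simp
  rw [h0] at hiff
  dsimp only at hψ₀ hψ
  have hψc : Tendsto ψ (𝓝 (α y₀)) (𝓝 y₀) := by
    have := hψ.self_of_nhds.continuousAt.tendsto
    rwa [hψ₀] at this
  have hgraph : Tendsto (fun x => (x, ψ x)) (𝓝 (α y₀)) (𝓝 (α y₀, y₀)) :=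
    tendsto_id.prodMk_nhds hψc
  refine ⟨ψ, hψ₀, ?_⟩
  filter_upwards [hψc (hα.isOpen_source.mem_nhds hy₀), hψ, hα.eventually_closest hy₀ hiff,
    hgraph.eventually hiff.eventually_nhds] with x hxV hxψ hxcl hxiff
  refine ⟨hxV, hxψ, fun q hq hxq => ?_, fun ν hν => ?_⟩
  · obtain ⟨hqU, hqN⟩ := hxcl q hq hxq
    obtain ⟨hβV, hβ⟩ := hα.inv_mem ⟨hq, hqU⟩
    have h1 : critEq α (x, β q) = 0 := hα.critEq_eq_zero_of_dist_eq hβV (by rwa [hβ])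
    have h2 : ψ x = β q := hqN.1 h1
    rw [h2, hβ]
  · have hx0 : critEq α (x, ψ x) = 0 := hxiff.self_of_nhds.2 rfl
    have hlim : Tendsto (fun t : ℝ => (x + t • ν, ψ x)) (𝓝 0) (𝓝 (x, ψ x)) := by
      have : Continuous fun t : ℝ => (x + t • ν, ψ x) := by fun_prop
      simpa using this.tendsto 0
    filter_upwards [hlim.eventually hxiff] with t ht
    refine ht.1 (critEq_eq_zero_iff.2 fun w => ?_)
    have h1 := critEq_eq_zero_iff.1 hx0 w
    dsimp only at h1 ⊢
    rw [add_sub_right_comm, inner_add_left, h1, inner_smul_left, hν w]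
    simp

/-- Near `α y₀` the map `α ∘ ψ` is the identity on `Γ`, so `Dα ∘ Dψ` fixes every vector of the
tangent cone, which therefore lies in the range. Conversely, `Dα` maps the tangent cone of the open
set `V`, which is everything, into that of `Γ`. -/
lemma tangentSpace_eq_range (hα : IsChart d Γ U V α β) {y₀ : EuclideanSpace ℝ (Fin d)}
    (hy₀ : y₀ ∈ V) : tangentSpace Γ (α y₀) =
      ((fderiv ℝ α y₀ : EuclideanSpace ℝ (Fin d) →ₗ[ℝ] Amb k)).range := by
  refine le_antisymm (Submodule.span_le.2 fun v hv => ?_) ?_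
  · obtain ⟨ψ, hψ₀, hψ⟩ := hα.exists_closest_coordinates hy₀
    have hd := (hψ.self_of_nhds.2.1.differentiableAt (by simp)).hasFDerivAt
    have hdα := hα.hasFDerivAt hy₀
    rw [← hψ₀] at hdα
    have hcomp := (hdα.comp (α y₀) hd).hasFDerivWithinAt (s := Γ)
    have hid : HasFDerivWithinAt (α ∘ ψ) (ContinuousLinearMap.id ℝ (Amb k)) Γ (α y₀) := by
      refine (hasFDerivWithinAt_id (α y₀) Γ).congr_of_eventuallyEq ?_ (by simp [hψ₀])
      filter_upwards [mem_nhdsWithin_of_mem_nhds hψ, self_mem_nhdsWithin] with x hx hxΓ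
      exact (hx.2.2.1 x hxΓ (by rw [dist_self, Metric.infDist_zero_of_mem hxΓ])).symm
    have h := hid.unique_on hcomp hv
    rw [hψ₀] at h
    exact ⟨_, h.symm⟩
  · rintro _ ⟨w, rfl⟩
    refine Submodule.subset_span ?_
    have h := (hα.hasFDerivAt hy₀).hasFDerivWithinAt (s := V) |>.mapsTo_tangent_cone
    rw [tangentConeAt_of_mem_nhds (hα.isOpen_source.mem_nhds hy₀), hα.image_eq] at h
    exact tangentConeAt_mono inter_subset_left (h (mem_univ w))

/-- The regularity properties of the closest point projection near `Γ`. -/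
lemma eventually_regular (hα : IsChart d Γ U V α β) (hcpt : IsCompact Γ)
    {y₀ : EuclideanSpace ℝ (Fin d)} (hy₀ : y₀ ∈ V) :
    ∀ᶠ x in 𝓝 (α y₀), (∃! q, q ∈ Γ ∧ dist x q = Metric.infDist x Γ) ∧
      ContDiffAt ℝ ∞ (closestPoint Γ) x ∧
      (∀ v, fderiv ℝ (closestPoint Γ) x v ∈ tangentSpace Γ (closestPoint Γ x)) ∧
      (∀ v ∈ (tangentSpace Γ (closestPoint Γ x))ᗮ, fderiv ℝ (closestPoint Γ) x v = 0) := by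
  have hΓ : Γ.Nonempty := ⟨_, (hα.mem hy₀).1⟩
  obtain ⟨ψ, hψ₀, hψ⟩ := hα.exists_closest_coordinates hy₀
  have hp : ∀ᶠ x in 𝓝 (α y₀), closestPoint Γ x = α (ψ x) := hψ.mono fun x hx =>
    hx.2.2.1 _ (closestPoint_spec hΓ hcpt x).1 (closestPoint_spec hΓ hcpt x).2
  filter_upwards [hψ, hp.eventually_nhds] with x ⟨hxV, hxψ, hxu, hxν⟩ hxp
  have hpx := hxp.self_of_nhds
  have heq : closestPoint Γ =ᶠ[𝓝 x] α ∘ ψ := hxp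
  have hd : HasFDerivAt (closestPoint Γ) (fderiv ℝ α (ψ x) ∘L fderiv ℝ ψ x) x :=
    ((hα.hasFDerivAt hxV).comp x
      (hxψ.differentiableAt (by simp)).hasFDerivAt).congr_of_eventuallyEq heq
  refine ⟨⟨closestPoint Γ x, closestPoint_spec hΓ hcpt x, fun q hq => ?_⟩,
    ((hα.contDiffAt hxV).comp x hxψ).congr_of_eventuallyEq heq, fun v => ?_, fun v hv => ?_⟩
  · rw [hpx]
    exact hxu q hq.1 hq.2
  · rw [hd.fderiv, hpx, hα.tangentSpace_eq_range hxV]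
    exact ⟨_, rfl⟩
  · rw [hpx, hα.tangentSpace_eq_range hxV] at hv
    have h1 := hxν v fun w =>
      Submodule.inner_left_of_mem_orthogonal (LinearMap.mem_range_self _ w) hv
    have h2 : HasDerivAt (fun t : ℝ => ψ (x + t • v)) (fderiv ℝ ψ x v) 0 := by
      have h3 : HasFDerivAt ψ (fderiv ℝ ψ x) (x + (0 : ℝ) • v) := by
        rw [zero_smul, add_zero]
        exact (hxψ.differentiableAt (by simp)).hasFDerivAt
      have h4 : HasDerivAt (fun t : ℝ => x + t • v) v 0 := by
        simpa using ((hasDerivAt_id (0 : ℝ)).smul_const v).const_add x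
      exact h3.comp_hasDerivAt 0 h4
    have h5 : fderiv ℝ ψ x v = 0 :=
      h2.unique ((hasDerivAt_const (0 : ℝ) (ψ x)).congr_of_eventuallyEq h1)
    rw [hd.fderiv, ContinuousLinearMap.comp_apply, h5, map_zero]

end IsChart

/-! ### From charts to a uniform tube, and the factor `H`. -/

section Tube

variable {k d : ℕ} {Γ : Set (Amb k)}

lemma IsSmoothSubmanifold.exists_chart (hsm : IsSmoothSubmanifold d Γ) {q : Amb k} (hq : q ∈ Γ) :
    ∃ (U : Set (Amb k)) (V : Set (EuclideanSpace ℝ (Fin d)))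
      (α : EuclideanSpace ℝ (Fin d) → Amb k) (β : Amb k → EuclideanSpace ℝ (Fin d)),
      IsChart d Γ U V α β ∧ ∃ y ∈ V, α y = q := by
  obtain ⟨U, V, α, β, h1, h2, h3, h4, h5, h6, h7, h8⟩ := hsm q hq
  have hα : IsChart d Γ U V α β := ⟨h1, h3, h4, h5, h6, h7, h8⟩
  exact ⟨U, V, α, β, hα, β q, hα.inv_mem ⟨hq, h2⟩⟩

lemma finrank_tangentSpace (hsm : IsSmoothSubmanifold d Γ) {q : Amb k} (hq : q ∈ Γ) :
    finrank ℝ (tangentSpace Γ q) = d := by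
  obtain ⟨U, V, α, β, hα, y, hy, rfl⟩ := hsm.exists_chart hq
  rw [hα.tangentSpace_eq_range hy, LinearMap.finrank_range_of_inj (hα.injective_fderiv y hy)]
  simp

lemma tube_eq_thickening (hΓ : Γ.Nonempty) (δ : ℝ) : tube Γ δ = Metric.thickening δ Γ := by
  ext x
  exact (Metric.mem_thickening_iff_infDist_lt hΓ).symm

lemma isOpen_tube (δ : ℝ) : IsOpen (tube Γ δ) :=
  isOpen_lt (Metric.continuous_infDist_pt Γ) continuous_const

/-- A tube on which the closest point projection is smooth and its derivative is controlled by the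
tangent spaces. -/
lemma exists_regular_tube (hΓ : Γ.Nonempty) (hcpt : IsCompact Γ) (hsm : IsSmoothSubmanifold d Γ) :
    ∃ δ : ℝ, IsTubeRadius Γ δ ∧ ∀ x ∈ tube Γ δ,
      tangentProj Γ (closestPoint Γ x) ∘L fderiv ℝ (closestPoint Γ) x =
        fderiv ℝ (closestPoint Γ) x ∧
      fderiv ℝ (closestPoint Γ) x ∘L tangentProj Γ (closestPoint Γ x) =
        fderiv ℝ (closestPoint Γ) x := by
  let good : Amb k → Prop := fun x => (∃! q, q ∈ Γ ∧ dist x q = Metric.infDist x Γ) ∧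
      ContDiffAt ℝ ∞ (closestPoint Γ) x ∧
      (∀ v, fderiv ℝ (closestPoint Γ) x v ∈ tangentSpace Γ (closestPoint Γ x)) ∧
      (∀ v ∈ (tangentSpace Γ (closestPoint Γ x))ᗮ, fderiv ℝ (closestPoint Γ) x v = 0)
  have hsub : Γ ⊆ interior {x | good x} := fun q hq => by
    obtain ⟨U, V, α, β, hα, y, hy, rfl⟩ := hsm.exists_chart hq
    exact mem_interior_iff_mem_nhds.2 (hα.eventually_regular hcpt hy)
  -- Compactness of `Γ` makes the local neighbourhoods uniform.
  obtain ⟨δ, hδ, hδΓ⟩ := hcpt.exists_thickening_subset_open isOpen_interior hsub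
  rw [← tube_eq_thickening hΓ] at hδΓ
  have hgood : ∀ x ∈ tube Γ δ, good x := fun x hx =>
    (interior_subset (hδΓ hx) : x ∈ {x | good x})
  refine ⟨δ, ⟨hδ, fun x hx => (hgood x hx).1, fun x hx => (hgood x hx).2.1.contDiffWithinAt⟩,
    fun x hx => ⟨?_, ?_⟩⟩
  · ext1 v
    exact Submodule.starProjection_eq_self_iff.2 ((hgood x hx).2.2.1 v)
  · ext1 v
    have h := (hgood x hx).2.2.2 _
      (Submodule.sub_starProjection_mem_orthogonal (K := tangentSpace Γ (closestPoint Γ x)) v)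
    rw [map_sub, sub_eq_zero] at h
    exact h.symm

/-- On `Γ`, the derivative of the closest point projection is the tangential projection. -/
lemma fderiv_closestPoint_of_mem (hcpt : IsCompact Γ) {q : Amb k} (hq : q ∈ Γ)
    (hd : DifferentiableAt ℝ (closestPoint Γ) q)
    (h : fderiv ℝ (closestPoint Γ) q ∘L tangentProj Γ (closestPoint Γ q) =
      fderiv ℝ (closestPoint Γ) q) :
    fderiv ℝ (closestPoint Γ) q = tangentProj Γ (closestPoint Γ q) := by
  have hid : HasFDerivWithinAt (closestPoint Γ) (ContinuousLinearMap.id ℝ (Amb k)) Γ q :=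
    (hasFDerivWithinAt_id q Γ).congr (fun x hx => closestPoint_of_mem hcpt hx)
      (closestPoint_of_mem hcpt hq)
  -- `p` is the identity on `Γ`, so its derivative fixes the tangent cone, hence its span; together
  -- with `h` this determines it.
  have hon := hd.hasFDerivAt.hasFDerivWithinAt.unique_on hid
  have hspan : ∀ v ∈ tangentSpace Γ q, fderiv ℝ (closestPoint Γ) q v = v := fun v hv =>
    LinearMap.eqOn_span (f := (fderiv ℝ (closestPoint Γ) q : Amb k →ₗ[ℝ] Amb k))
      (g := LinearMap.id) hon hv
  rw [← h, closestPoint_of_mem hcpt hq]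
  ext1 v
  exact hspan _ (Submodule.starProjection_apply_mem _ _)

/-- The derivative of the closest point projection differs from the tangential projection by
at most a multiple of the distance to `Γ`. -/
lemma exists_tube_bounds (hΓ : Γ.Nonempty) (hcpt : IsCompact Γ) (hsm : IsSmoothSubmanifold d Γ) :
    ∃ δ M : ℝ, IsTubeRadius Γ δ ∧ 0 ≤ M ∧ ∀ x ∈ tube Γ δ,
      tangentProj Γ (closestPoint Γ x) ∘L fderiv ℝ (closestPoint Γ) x =
        fderiv ℝ (closestPoint Γ) x ∧
      fderiv ℝ (closestPoint Γ) x ∘L tangentProj Γ (closestPoint Γ x) =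
        fderiv ℝ (closestPoint Γ) x ∧
      ‖fderiv ℝ (closestPoint Γ) x - tangentProj Γ (closestPoint Γ x)‖ ≤
        M * Metric.infDist x Γ := by
  obtain ⟨δ₁, hδ₁, hP⟩ := exists_regular_tube hΓ hcpt hsm
  have hopen := isOpen_tube (Γ := Γ) δ₁
  set p := closestPoint Γ with hp
  have hpos := hδ₁.pos
  -- With half the radius, the closed thickening is compact inside the open tube, so the second
  -- derivative of `p` is bounded on it.
  set δ := δ₁ / 2 with hδ
  have hδ0 : 0 < δ := half_pos hpos
  have hKsub : Metric.cthickening δ Γ ⊆ tube Γ δ₁ := by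
    rw [tube_eq_thickening hΓ]
    exact Metric.cthickening_subset_thickening' hpos (half_lt_self hpos) Γ
  have hp2 : ContDiffOn ℝ ∞ (fderiv ℝ p) (tube Γ δ₁) :=
    hδ₁.contDiffOn.fderiv_of_isOpen hopen (by simp)
  have hcont : ContinuousOn (fderiv ℝ (fderiv ℝ p)) (Metric.cthickening δ Γ) :=
    (hp2.continuousOn_fderiv_of_isOpen hopen (by simp)).mono hKsub
  obtain ⟨M, hM⟩ := (hcpt.cthickening (r := δ)).exists_bound_of_continuousOn
    (E := Amb k →L[ℝ] Amb k →L[ℝ] Amb k) hcont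
  have hsubt : tube Γ δ ⊆ tube Γ δ₁ := fun x hx => lt_trans hx (half_lt_self hpos)
  refine ⟨δ, max M 0, ⟨hδ0, fun x hx => hδ₁.existsUnique_closest x (hsubt hx),
    hδ₁.contDiffOn.mono hsubt⟩, le_max_right _ _, fun x hx =>
      ⟨(hP x (hsubt hx)).1, (hP x (hsubt hx)).2, ?_⟩⟩
  obtain ⟨hpΓ, hpd⟩ := closestPoint_spec hΓ hcpt x
  -- The segment from `p x` to `x` stays within `ρ(x)` of `p x`, so the mean value inequality
  -- applies to `Dp` along it.
  have hseg : segment ℝ (p x) x ⊆ Metric.cthickening δ Γ := fun z hz => by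
    refine Metric.mem_cthickening_of_dist_le z (p x) δ Γ hpΓ ?_
    have h1 : dist z (p x) ≤ dist x (p x) := by
      have := (convex_closedBall (p x) (dist x (p x))).segment_subset
        (Metric.mem_closedBall_self dist_nonneg) (Metric.mem_closedBall.2 le_rfl) hz
      exact this
    rw [hpd] at h1
    exact h1.trans (le_of_lt hx)
  have hmv := (convex_segment (p x) x).norm_image_sub_le_of_norm_fderiv_le (𝕜 := ℝ)
    (f := fderiv ℝ p) (C := max M 0)
    (fun z hz => ((hp2.contDiffAt (hopen.mem_nhds (hKsub (hseg hz)))).differentiableAt (by simp)))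
    (fun z hz => (hM z (hseg hz)).trans (le_max_left _ _))
    (left_mem_segment ℝ (p x) x) (right_mem_segment ℝ (p x) x)
  have hΓt : p x ∈ tube Γ δ₁ := by
    change Metric.infDist (p x) Γ < δ₁
    rw [Metric.infDist_zero_of_mem hpΓ]
    exact hpos
  have hq := fderiv_closestPoint_of_mem hcpt hpΓ
    ((hδ₁.contDiffOn.contDiffAt (hopen.mem_nhds hΓt)).differentiableAt (by simp)) (hP _ hΓt).2
  rw [closestPoint_of_mem hcpt hpΓ] at hq
  rw [← hp] at hq hpd
  rwa [hq, ← dist_eq_norm x, hpd] at hmv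

/-- The matrix field `H = ρ⁻¹ (P_Γ - Dp)`. -/
lemma exists_isTubeFactor {δ M : ℝ} (hM : 0 ≤ M)
    (h : ∀ x ∈ tube Γ δ,
      tangentProj Γ (closestPoint Γ x) ∘L fderiv ℝ (closestPoint Γ) x =
        fderiv ℝ (closestPoint Γ) x ∧
      fderiv ℝ (closestPoint Γ) x ∘L tangentProj Γ (closestPoint Γ x) =
        fderiv ℝ (closestPoint Γ) x ∧
      ‖fderiv ℝ (closestPoint Γ) x - tangentProj Γ (closestPoint Γ x)‖ ≤
        M * Metric.infDist x Γ) :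
    ∃ H : Amb k → Amb k →L[ℝ] Amb k, IsTubeFactor Γ δ H := by
  have hPP : ∀ q : Amb k, tangentProj Γ q ∘L tangentProj Γ q = tangentProj Γ q := fun q => by
    ext1 v
    exact Submodule.starProjection_eq_self_iff.2 (Submodule.starProjection_apply_mem _ _)
  refine ⟨fun x => (Metric.infDist x Γ)⁻¹ •
    (tangentProj Γ (closestPoint Γ x) - fderiv ℝ (closestPoint Γ) x),
    fun x hx => ?_, fun x hx => ?_, M, fun x hx => ?_⟩
  · obtain ⟨h1, h2, h3⟩ := h x hx
    -- Where `ρ = 0`, the convention `0⁻¹ = 0` gives `H = 0`, and the bound forces `Dp = P_Γ`.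
    rcases eq_or_ne (Metric.infDist x Γ) 0 with h0 | h0
    · rw [h0, mul_zero] at h3
      have h4 := sub_eq_zero.1 (norm_le_zero_iff.1 h3)
      rw [h4, sub_self, smul_zero, smul_zero, sub_zero, ContinuousLinearMap.comp_id]
    · rw [smul_smul, mul_inv_cancel₀ h0, one_smul, ContinuousLinearMap.comp_sub,
        ContinuousLinearMap.comp_sub, ContinuousLinearMap.comp_id, hPP, h1, sub_sub_cancel]
  · obtain ⟨h1, h2, h3⟩ := h x hx
    rw [ContinuousLinearMap.smul_comp, ContinuousLinearMap.sub_comp, hPP, h2]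
  · obtain ⟨h1, h2, h3⟩ := h x hx
    rw [norm_smul, norm_sub_rev, norm_inv, Real.norm_of_nonneg Metric.infDist_nonneg]
    rcases eq_or_ne (Metric.infDist x Γ) 0 with h0 | h0
    · simp [h0, hM]
    · rw [inv_mul_le_iff₀ (lt_of_le_of_ne Metric.infDist_nonneg h0.symm), mul_comm]
      exact h3

end Tube

/-! ### Perturbation of orthogonal projections, with quadratic dependence on their gap. -/

section LinearAlgebra

variable {E : Type*} [NormedAddCommGroup E] [InnerProductSpace ℝ E] [FiniteDimensional ℝ E]
  {T S : Submodule ℝ E} {D : E →L[ℝ] E} {a b : ℝ}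

lemma norm_apply_le_of_norm_sub_le (hD : ‖D - T.starProjection‖ ≤ a) (v : E) :
    ‖D v‖ ≤ (1 + a) * ‖v‖ := by
  have h1 : ‖D v - T.starProjection v‖ ≤ a * ‖v‖ :=
    ((D - T.starProjection).le_opNorm v).trans (by gcongr)
  have h2 := norm_le_norm_add_norm_sub' (D v) (T.starProjection v)
  have h3 := Submodule.norm_starProjection_apply_le T v
  linarith

lemma norm_comp_starProjection_le (hD : ‖D - T.starProjection‖ ≤ a) :
    ‖D ∘L S.starProjection‖ ≤ 1 + a := by
  have ha : 0 ≤ a := (norm_nonneg _).trans hD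
  refine ContinuousLinearMap.opNorm_le_bound _ (by positivity) fun v => ?_
  refine (norm_apply_le_of_norm_sub_le hD _).trans ?_
  gcongr
  exact Submodule.norm_starProjection_apply_le S v

/-- Expanding `D = P + (D - P)` leaves `P - PQP = P(P - Q)(P - Q)P`, quadratic in the gap `b`, plus
terms linear and quadratic in `a`. It is applied with `a` of order `h²` and `b` of order `h`. -/
lemma norm_starProjection_sub_comp_adjoint_le (hD : ‖D - T.starProjection‖ ≤ a)
    (hTS : ‖T.starProjection - S.starProjection‖ ≤ b) :
    ‖T.starProjection - (D ∘L S.starProjection) ∘L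
      ContinuousLinearMap.adjoint (D ∘L S.starProjection)‖ ≤ b ^ 2 + 2 * a + a ^ 2 := by
  have ha : 0 ≤ a := (norm_nonneg _).trans hD
  have hb : 0 ≤ b := (norm_nonneg _).trans hTS
  set P := T.starProjection with hP
  set Q := S.starProjection with hQ
  have hPP : P * P = P := T.isIdempotentElem_starProjection
  have hQQ : Q * Q = Q := S.isIdempotentElem_starProjection
  have hPs : star P = P := (isSelfAdjoint_starProjection T).star_eq
  have hQs : star Q = Q := (isSelfAdjoint_starProjection S).star_eq
  have hP1 : ‖P‖ ≤ 1 := T.starProjection_norm_le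
  have hQ1 : ‖Q‖ ≤ 1 := S.starProjection_norm_le
  change ‖P - (D * Q) * star (D * Q)‖ ≤ _
  have hR : ‖star (D - P)‖ ≤ a :=
    (ContinuousLinearMap.adjoint.norm_map (D - P)).trans_le hD
  have hid : P - (D * Q) * star (D * Q) =
      P * (P - Q) * (P - Q) * P - (D - P) * Q * P - P * Q * star (D - P) -
        (D - P) * Q * star (D - P) := by
    have h1 : P * (P - Q) * (P - Q) * P = P - P * Q * P := by
      have h2 : P * (P - Q) * (P - Q) * P =
          P * P * P * P - P * P * (Q * P) - P * Q * (P * P) + P * (Q * Q) * P := by noncomm_ring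
      rw [h2, hQQ, hPP, hPP, hPP]
      noncomm_ring
    have h3 : (D * Q) * star (D * Q) = D * Q * star D := by
      rw [star_mul, hQs, mul_assoc, ← mul_assoc Q, hQQ, ← mul_assoc]
    rw [h1, h3, star_sub, hPs]
    noncomm_ring
  rw [hid]
  have e1 : ‖P * (P - Q) * (P - Q) * P‖ ≤ 1 * b * b * 1 := norm_mul_le_of_le
    (norm_mul_le_of_le (norm_mul_le_of_le hP1 hTS) hTS) hP1
  have e2 : ‖(D - P) * Q * P‖ ≤ a * 1 * 1 := norm_mul_le_of_le (norm_mul_le_of_le hD hQ1) hP1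
  have e3 : ‖P * Q * star (D - P)‖ ≤ 1 * 1 * a :=
    norm_mul_le_of_le (norm_mul_le_of_le hP1 hQ1) hR
  have e4 : ‖(D - P) * Q * star (D - P)‖ ≤ a * 1 * a :=
    norm_mul_le_of_le (norm_mul_le_of_le hD hQ1) hR
  refine (norm_sub_le_of_le (norm_sub_le_of_le (norm_sub_le_of_le e1 e2) e3) e4).trans
    (le_of_eq (by ring))

/-- By Pythagoras `‖v‖² - ‖P v‖² = ‖v - P v‖²`, and for `v ∈ S` the vector `v - P v` is the gap of
the projections applied to `v` up to sign; so `b` enters squared. -/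
lemma abs_norm_sq_sub_norm_sq_le (hD : ‖D - T.starProjection‖ ≤ a)
    (hTS : ‖T.starProjection - S.starProjection‖ ≤ b) {v : E} (hv : v ∈ S) :
    |‖D v‖ ^ 2 - ‖v‖ ^ 2| ≤ (b ^ 2 + 2 * a + a ^ 2) * ‖v‖ ^ 2 := by
  have ha : 0 ≤ a := (norm_nonneg _).trans hD
  set P := T.starProjection with hP
  have h1 : ‖D v - P v‖ ≤ a * ‖v‖ := ((D - P).le_opNorm v).trans (by gcongr)
  have h2 : ‖P v‖ ≤ ‖v‖ := Submodule.norm_starProjection_apply_le T v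
  have h3 : ‖D v‖ ≤ (1 + a) * ‖v‖ := norm_apply_le_of_norm_sub_le hD v
  have h4 : ‖v - P v‖ ≤ b * ‖v‖ := by
    have h := ((P - S.starProjection).le_opNorm v).trans
      (mul_le_mul_of_nonneg_right hTS (norm_nonneg v))
    rwa [_root_.sub_apply, Submodule.starProjection_eq_self_iff.2 hv, norm_sub_rev] at h
  have h5 : ‖v‖ ^ 2 = ‖P v‖ ^ 2 + ‖v - P v‖ ^ 2 := by
    have h := norm_add_sq_eq_norm_sq_add_norm_sq_of_inner_eq_zero (P v) (v - P v)
      (Submodule.inner_right_of_mem_orthogonal (Submodule.starProjection_apply_mem _ _)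
        (Submodule.sub_starProjection_mem_orthogonal v))
    rw [add_sub_cancel] at h
    nlinarith [h]
  have h6 : |‖D v‖ - ‖P v‖| ≤ a * ‖v‖ := (abs_norm_sub_norm_le _ _).trans h1
  have h7 : |‖D v‖ ^ 2 - ‖P v‖ ^ 2| ≤ a * ‖v‖ * ((1 + a) * ‖v‖ + ‖v‖) := by
    rw [sq_sub_sq, abs_mul, mul_comm, abs_of_nonneg (add_nonneg (norm_nonneg _) (norm_nonneg _))]
    gcongr
  have h8 : ‖v - P v‖ ^ 2 ≤ (b * ‖v‖) ^ 2 := by gcongr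
  calc |‖D v‖ ^ 2 - ‖v‖ ^ 2| = |(‖D v‖ ^ 2 - ‖P v‖ ^ 2) - ‖v - P v‖ ^ 2| := by rw [h5]; ring_nf
    _ ≤ |‖D v‖ ^ 2 - ‖P v‖ ^ 2| + |‖v - P v‖ ^ 2| := abs_sub _ _
    _ ≤ a * ‖v‖ * ((1 + a) * ‖v‖ + ‖v‖) + (b * ‖v‖) ^ 2 := by
      rw [abs_of_nonneg (sq_nonneg ‖v - P v‖)]
      gcongr
    _ = _ := by ring

/-- A linear map between spaces of equal dimension that nearly preserves lengths is invertible. -/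
lemma exists_continuousLinearEquiv_of_norm_sq {V W : Type*} [NormedAddCommGroup V]
    [NormedSpace ℝ V] [FiniteDimensional ℝ V] [NormedAddCommGroup W]
    [NormedSpace ℝ W] [FiniteDimensional ℝ W] (hVW : finrank ℝ V = finrank ℝ W)
    (A : V →L[ℝ] W) {ε : ℝ} (hε : ε ≤ 1 / 2) (h : ∀ v, |‖A v‖ ^ 2 - ‖v‖ ^ 2| ≤ ε * ‖v‖ ^ 2) :
    ∃ e : V ≃L[ℝ] W, (e : V →L[ℝ] W) = A ∧ ‖(e.symm : W →L[ℝ] V)‖ ≤ 2 := by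
  -- From `ε ≤ 1/2`, `‖A v‖² ≥ ‖v‖² / 2`. This coercivity gives injectivity, and the constant `2`
  -- bounds the inverse.
  have hle : ∀ v, ‖v‖ ≤ 2 * ‖A v‖ := fun v => by
    have h1 := (abs_le.1 (h v)).1
    have h2 : ‖v‖ ^ 2 ≤ (2 * ‖A v‖) ^ 2 := by nlinarith [sq_nonneg ‖v‖, sq_nonneg ‖A v‖]
    exact (pow_le_pow_iff_left₀ (norm_nonneg _) (by positivity) two_ne_zero).1 h2
  have hinj : Function.Injective (A : V →ₗ[ℝ] W) := by
    rw [injective_iff_map_eq_zero]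
    intro v hv
    have h1 := hle v
    rw [show A v = 0 from hv, norm_zero, mul_zero] at h1
    exact norm_le_zero_iff.1 h1
  refine ⟨(LinearEquiv.ofInjectiveOfFinrankEq (A : V →ₗ[ℝ] W) hinj hVW).toContinuousLinearEquiv,
    by ext; rfl, ContinuousLinearMap.opNorm_le_bound _ zero_le_two fun w => ?_⟩
  set e := (LinearEquiv.ofInjectiveOfFinrankEq (A : V →ₗ[ℝ] W) hinj hVW).toContinuousLinearEquiv
  have h1 := hle (e.symm w)
  rwa [show A (e.symm w) = w from e.apply_symm_apply w] at h1

end LinearAlgebra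

/-! ### Hausdorff measure of subsets of affine subspaces. -/

section AffineMeasure

variable {E : Type*} [NormedAddCommGroup E] [InnerProductSpace ℝ E] [MeasurableSpace E]
  [BorelSpace E] {V₀ : Submodule ℝ E} [FiniteDimensional ℝ V₀] {x₀ : E} {S : Set E}

omit [MeasurableSpace E] [BorelSpace E] [FiniteDimensional ℝ V₀] in
lemma isometry_coe_add (V₀ : Submodule ℝ E) (x₀ : E) : Isometry fun v : V₀ => (v : E) + x₀ :=
  (IsometryEquiv.addRight x₀).isometry.comp isometry_subtype_coe

omit [MeasurableSpace E] [BorelSpace E] [FiniteDimensional ℝ V₀] in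
lemma image_preimage_coe_add (hSV : ∀ x ∈ S, x - x₀ ∈ V₀) :
    (fun v : V₀ => (v : E) + x₀) '' ((fun v : V₀ => (v : E) + x₀) ⁻¹' S) = S :=
  image_preimage_eq_of_subset fun x hx => ⟨⟨x - x₀, hSV x hx⟩, by simp⟩

lemma euclideanHausdorffMeasure_lt_top_of_isCompact (hS : IsCompact S)
    (hSV : ∀ x ∈ S, x - x₀ ∈ V₀) :
    (Measure.euclideanHausdorffMeasure (finrank ℝ V₀) : Measure E) S < ⊤ := by
  have hι := isometry_coe_add V₀ x₀
  rw [← image_preimage_coe_add hSV, hι.euclideanHausdorffMeasure_image,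
    InnerProductSpace.euclideanHausdorffMeasure_eq_volume]
  exact (hι.isClosedEmbedding.isCompact_preimage hS).measure_lt_top

/-- The set is an isometric copy of a subset of a space of Hausdorff dimension below `d`. It is used
for the common faces of two cells. -/
lemma euclideanHausdorffMeasure_eq_zero_of_finrank_lt {d : ℕ} (hd : finrank ℝ V₀ < d)
    (hSV : ∀ x ∈ S, x - x₀ ∈ V₀) :
    (Measure.euclideanHausdorffMeasure d : Measure E) S = 0 := by
  have hι := isometry_coe_add V₀ x₀
  rw [← image_preimage_coe_add hSV, hι.euclideanHausdorffMeasure_image]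
  refine measure_mono_null (subset_univ _) ?_
  rw [Measure.euclideanHausdorffMeasure_def, Measure.smul_apply]
  have h : dimH (univ : Set V₀) < ((d : NNReal) : ℝ≥0∞) := by
    rw [Real.dimH_univ_eq_finrank]
    exact_mod_cast hd
  have h0 := hausdorffMeasure_of_dimH_lt h
  rw [NNReal.coe_natCast] at h0
  rw [h0, smul_zero]

end AffineMeasure

/-! ### Measure and dimension of the cells of a mesh. -/

section Simplex

variable {k d : ℕ}

lemma sub_mem_vectorSpan_of_mem_convexHull {s : Set (Amb k)} {x y : Amb k}
    (hx : x ∈ convexHull ℝ s) (hy : y ∈ convexHull ℝ s) : x - y ∈ vectorSpan ℝ s := by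
  rw [← direction_affineSpan]
  exact AffineSubspace.vsub_mem_direction (convexHull_subset_affineSpan s hx)
    (convexHull_subset_affineSpan s hy)

lemma finrank_vectorSpan_of_mem_cells {𝒦 : Geometry.SimplicialComplex ℝ (Amb k)}
    {K : Finset (Amb k)} (hK : K ∈ cells d 𝒦) :
    finrank ℝ (vectorSpan ℝ (K : Set (Amb k))) = d := by
  have h := (𝒦.indep hK.1).finrank_vectorSpan (n := d) (by simpa using hK.2)
  have hs : ∀ s : Set (Amb k), range (Subtype.val : {x // x ∈ K} → Amb k) = s →
      finrank ℝ (vectorSpan ℝ s) = d := by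
    rintro _ rfl
    exact h
  exact hs _ (by simp)

lemma isCompact_convexHull_finset (K : Finset (Amb k)) :
    IsCompact (convexHull ℝ (K : Set (Amb k))) :=
  K.finite_toSet.isCompact_convexHull ℝ

lemma riemMeasure_convexHull_lt_top {𝒦 : Geometry.SimplicialComplex ℝ (Amb k)}
    {K : Finset (Amb k)} (hK : K ∈ cells d 𝒦) :
    riemMeasure d (convexHull ℝ (K : Set (Amb k))) < ⊤ := by
  obtain ⟨x₀, hx₀⟩ := 𝒦.nonempty_of_mem_faces hK.1
  have h := euclideanHausdorffMeasure_lt_top_of_isCompact (isCompact_convexHull_finset K)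
    (V₀ := vectorSpan ℝ (K : Set (Amb k))) (x₀ := x₀) fun x hx =>
      sub_mem_vectorSpan_of_mem_convexHull hx (subset_convexHull ℝ _ hx₀)
  rwa [finrank_vectorSpan_of_mem_cells hK] at h

/-- Distinct cells of a mesh overlap in a null set. -/
lemma riemMeasure_convexHull_inter_eq_zero {𝒦 : Geometry.SimplicialComplex ℝ (Amb k)}
    {K K' : Finset (Amb k)} (hK : K ∈ cells d 𝒦) (hK' : K' ∈ cells d 𝒦) (hne : K ≠ K') :
    riemMeasure d (convexHull ℝ (K : Set (Amb k)) ∩ convexHull ℝ (K' : Set (Amb k))) = 0 := by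
  classical
  rw [𝒦.convexHull_inter_convexHull hK.1 hK'.1, ← Finset.coe_inter]
  rcases (K ∩ K').eq_empty_or_nonempty with h0 | ⟨x₀, hx₀⟩
  · simp [h0]
  -- Distinct cells have equally many vertices, so they share at most `d` of them, which span a
  -- direction space of dimension at most `d - 1`.
  · have hcard : (K ∩ K').card < d + 1 := by
      rw [← hK.2]
      refine Finset.card_lt_card (Finset.ssubset_iff_subset_ne.2 ⟨Finset.inter_subset_left, ?_⟩)
      intro h
      exact hne (Finset.eq_of_subset_of_card_le (Finset.inter_eq_left.1 h)
        (by rw [hK.2, hK'.2]))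
    have hpos : 0 < (K ∩ K').card := Finset.card_pos.2 ⟨x₀, hx₀⟩
    have hrank : finrank ℝ (vectorSpan ℝ ((K ∩ K' : Finset (Amb k)) : Set (Amb k))) < d := by
      have h := finrank_vectorSpan_image_finset_le ℝ (id : Amb k → Amb k) (K ∩ K')
        (n := (K ∩ K').card - 1) (by omega)
      rw [Finset.image_id] at h
      omega
    exact euclideanHausdorffMeasure_eq_zero_of_finrank_lt hrank (x₀ := x₀) fun x hx =>
      sub_mem_vectorSpan_of_mem_convexHull hx (subset_convexHull ℝ _ hx₀)

lemma IsClosedMesh.space_eq {𝒦 : Geometry.SimplicialComplex ℝ (Amb k)} (h : IsClosedMesh d 𝒦) :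
    𝒦.space = ⋃ K : cells d 𝒦, convexHull ℝ ((K : Finset (Amb k)) : Set (Amb k)) := by
  refine subset_antisymm (fun x hx => ?_) (iUnion_subset fun K =>
    𝒦.convexHull_subset_space K.2.1)
  obtain ⟨s, hs, hxs⟩ := 𝒦.mem_space_iff.1 hx
  obtain ⟨K, hK, hsK⟩ := h.pure s hs
  exact mem_iUnion.2 ⟨⟨K, hK⟩, convexHull_mono (Finset.coe_subset.2 hsK) hxs⟩

end Simplex

/-! ### Estimates and change of variables on a single cell. -/

section Cell

variable {k d : ℕ} {Γ : Set (Amb k)} {δ : ℝ} {H : Amb k → Amb k →L[ℝ] Amb k}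
  {K : Finset (Amb k)} {x : Amb k}

/-- The factorization of `Dp` makes `B` independent of the choice of `H`; this is why one set of
constants serves every admissible `H`. -/
lemma IsTubeFactor.matB_eq (hH : IsTubeFactor Γ δ H) (hx : x ∈ tube Γ δ) :
    matB Γ H K x = fderiv ℝ (closestPoint Γ) x ∘L cellProj K := by
  rw [matB, hH.fderiv_eq x hx, ContinuousLinearMap.comp_assoc]

lemma IsTubeFactor.coe_tanB (hH : IsTubeFactor Γ δ H) (hx : x ∈ tube Γ δ)
    (v : vectorSpan ℝ (K : Set (Amb k))) :
    (tanB Γ H K x v : Amb k) = fderiv ℝ (closestPoint Γ) x v := by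
  change matB Γ H K x v = _
  rw [hH.matB_eq hx, ContinuousLinearMap.comp_apply, cellProj,
    Submodule.starProjection_eq_self_iff.2 v.2]

/-- Restricting the codomain to the tangent space does not change `normDet`, so `|B|_d` is exactly
the Jacobian in the area formula. -/
lemma IsTubeFactor.absDet_tanB (hH : IsTubeFactor Γ δ H) (hx : x ∈ tube Γ δ) :
    absDet (tanB Γ H K x) = ((fderiv ℝ (closestPoint Γ) x ∘L
      (vectorSpan ℝ (K : Set (Amb k))).subtypeL :
        vectorSpan ℝ (K : Set (Amb k)) →L[ℝ] Amb k) :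
        vectorSpan ℝ (K : Set (Amb k)) →ₗ[ℝ] Amb k).normDet := by
  rw [absDet_eq_normDet]
  refine (LinearMap.normDet_codRestrict (p := tangentSpace Γ (closestPoint Γ x))
    (f := ((matB Γ H K x ∘L (vectorSpan ℝ (K : Set (Amb k))).subtypeL :
      vectorSpan ℝ (K : Set (Amb k)) →L[ℝ] Amb k) : vectorSpan ℝ (K : Set (Amb k)) →ₗ[ℝ] Amb k))
    (fun v => matB_mem Γ H K x v)).trans ?_
  congr 1
  exact LinearMap.ext fun v => hH.coe_tanB hx v

/-- The pointwise geometric estimates on a cell, with explicit constants. -/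
lemma IsTubeFactor.cell_estimates (hcpt : IsCompact Γ) (hΓ : Γ.Nonempty)
    (hsm : IsSmoothSubmanifold d Γ) (hH : IsTubeFactor Γ δ H) (hx : x ∈ tube Γ δ)
    {𝒦 : Geometry.SimplicialComplex ℝ (Amb k)} (hK : K ∈ cells d 𝒦) {a b ε : ℝ}
    (hD : ‖fderiv ℝ (closestPoint Γ) x - tangentProj Γ (closestPoint Γ x)‖ ≤ a)
    (hb : ‖tangentProj Γ (closestPoint Γ x) - cellProj K‖ ≤ b)
    (hab : b ^ 2 + 2 * a + a ^ 2 ≤ ε) (hε : ε ≤ 1 / 2) :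
    ‖matB Γ H K x‖ ≤ 1 + a ∧
    (∃ e : vectorSpan ℝ (K : Set (Amb k)) ≃L[ℝ] tangentSpace Γ (closestPoint Γ x),
      (e : vectorSpan ℝ (K : Set (Amb k)) →L[ℝ] tangentSpace Γ (closestPoint Γ x)) =
        tanB Γ H K x ∧
      ‖(e.symm : tangentSpace Γ (closestPoint Γ x) →L[ℝ] vectorSpan ℝ (K : Set (Amb k)))‖ ≤ 2) ∧
    ‖tangentProj Γ (closestPoint Γ x) -
      matB Γ H K x ∘L ContinuousLinearMap.adjoint (matB Γ H K x)‖ ≤ ε ∧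
    |1 - absDet (tanB Γ H K x)| ≤ d * 2 ^ d * ε := by
  have hε0 : 0 ≤ ε := by
    have := (norm_nonneg _).trans hD
    exact le_trans (by positivity) hab
  have hlen : ∀ v, |‖tanB Γ H K x v‖ ^ 2 - ‖v‖ ^ 2| ≤ ε * ‖v‖ ^ 2 := fun v => by
    have h := abs_norm_sq_sub_norm_sq_le hD hb v.2
    rw [← hH.coe_tanB hx v] at h
    exact h.trans (by
      rw [Submodule.coe_norm]
      gcongr)
  have hrank := finrank_vectorSpan_of_mem_cells hK
  refine ⟨?_, ?_, ?_, ?_⟩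
  · rw [hH.matB_eq hx]
    exact norm_comp_starProjection_le hD
  · refine exists_continuousLinearEquiv_of_norm_sq ?_ _ hε hlen
    rw [hrank, finrank_tangentSpace hsm (closestPoint_spec hΓ hcpt x).1]
  · rw [hH.matB_eq hx]
    exact (norm_starProjection_sub_comp_adjoint_le hD hb).trans hab
  · have h := abs_one_sub_absDet_le (tanB Γ H K x) hε0 (by linarith) hlen
    rwa [hrank] at h

/-- The change of variables formula for the closest point projection on a cell. -/
lemma IsTubeFactor.riemMeasure_image (hδ : IsTubeRadius Γ δ) (hH : IsTubeFactor Γ δ H)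
    {𝒦 : Geometry.SimplicialComplex ℝ (Amb k)} (hK : K ∈ cells d 𝒦) {A : Set (Amb k)}
    (hA : MeasurableSet A) (hAK : A ⊆ convexHull ℝ (K : Set (Amb k))) (hAt : A ⊆ tube Γ δ)
    (hinj : InjOn (closestPoint Γ) A)
    (hB : ∀ x ∈ A, Function.Injective (tanB Γ H K x)) :
    riemMeasure d (closestPoint Γ '' A) =
      ∫⁻ x in A, ENNReal.ofReal (absDet (tanB Γ H K x)) ∂(riemMeasure d) := by
  obtain ⟨x₀, hx₀⟩ := 𝒦.nonempty_of_mem_faces hK.1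
  have h := euclideanHausdorffMeasure_image_eq_setLIntegral_normDet
    (V₀ := vectorSpan ℝ (K : Set (Amb k))) (x₀ := x₀) (f := closestPoint Γ) hA
    (fun x hx => sub_mem_vectorSpan_of_mem_convexHull (hAK hx) (subset_convexHull ℝ _ hx₀))
    (fun x hx => (hδ.contDiffOn.contDiffAt ((isOpen_tube δ).mem_nhds (hAt hx))).of_le (by simp))
    (fun x hx => by
      rw [LinearMap.ker_eq_bot']
      intro v hv
      refine hB x hx ?_
      rw [map_zero, Subtype.ext_iff, hH.coe_tanB (hAt hx)]
      exact hv) hinj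
  rw [finrank_vectorSpan_of_mem_cells hK] at h
  refine h.trans (setLIntegral_congr_fun hA fun x hx => ?_)
  rw [hH.absDet_tanB (hAt hx)]

end Cell

/-! ### Summation over the cells of the mesh. -/

/-- The measure of an injective image of a subset of a mesh is the sum over the cells, provided
null sets have null images. -/
lemma IsClosedMesh.measure_eq_tsum {k d : ℕ} {𝒦 : Geometry.SimplicialComplex ℝ (Amb k)}
    (hm : IsClosedMesh d 𝒦) {f : Amb k → Amb k} {S : Set (Amb k)} (hS : MeasurableSet S)
    (hSs : S ⊆ 𝒦.space) (hf : ContinuousOn f S) (hinj : InjOn f S)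
    (hnull : ∀ A ⊆ S, MeasurableSet A → riemMeasure d A = 0 → riemMeasure d (f '' A) = 0) :
    riemMeasure d (f '' S) = ∑' K : cells d 𝒦, riemMeasure d
      (f '' (S ∩ convexHull ℝ ((K : Finset (Amb k)) : Set (Amb k)))) := by
  have : Countable (cells d 𝒦) := (hm.finite.subset fun K hK => hK.1).countable.to_subtype
  have hmeas : ∀ K : Finset (Amb k), MeasurableSet (convexHull ℝ (K : Set (Amb k))) := fun K =>
    (isCompact_convexHull_finset K).measurableSet
  have hS' : S = ⋃ K : cells d 𝒦,
      S ∩ convexHull ℝ ((K : Finset (Amb k)) : Set (Amb k)) := by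
    rw [← inter_iUnion, ← hm.space_eq, inter_eq_left.2 hSs]
  conv_lhs => rw [hS', image_iUnion]
  refine measure_iUnion₀ (fun K K' hne => ?_) fun K => ?_
  -- Injectivity turns the overlap of two images into the image of an overlap, which is null since
  -- distinct cells meet in a null set.
  · change riemMeasure d (_ ∩ _) = 0
    rw [← hinj.image_inter inter_subset_left inter_subset_left]
    refine hnull _ (inter_subset_left.trans inter_subset_left)
      ((hS.inter (hmeas _)).inter (hS.inter (hmeas _))) ?_
    exact measure_mono_null (inter_subset_inter inter_subset_right inter_subset_right)
      (riemMeasure_convexHull_inter_eq_zero K.2 K'.2 fun h => hne (Subtype.ext h))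
  · exact ((hS.inter (hmeas _)).image_of_continuousOn_injOn (hf.mono inter_subset_left)
      (hinj.mono inter_subset_left)).nullMeasurableSet

/-- The measure-theoretic consequences of pointwise bounds for the Jacobian. -/
lemma IsDiscreteManifold.measure_estimates {k d : ℕ} {Γ : Set (Amb k)} {δ c h η : ℝ}
    {H : Amb k → Amb k →L[ℝ] Amb k} {𝒦 : Geometry.SimplicialComplex ℝ (Amb k)}
    (hδ : IsTubeRadius Γ δ) (hH : IsTubeFactor Γ δ H) (h𝒦 : IsDiscreteManifold d Γ δ c h 𝒦)
    (hB : ∀ K ∈ cells d 𝒦, ∀ x ∈ convexHull ℝ (K : Set (Amb k)),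
      Function.Injective (tanB Γ H K x) ∧ |1 - absDet (tanB Γ H K x)| ≤ η)
    (hη0 : 0 ≤ η) (hη1 : η ≤ 1) {S : Set (Amb k)} (hS : MeasurableSet S) (hSs : S ⊆ 𝒦.space) :
    riemMeasure d S < ⊤ ∧
    riemMeasure d (closestPoint Γ '' S) = ∑' K : cells d 𝒦,
      ∫⁻ x in S ∩ convexHull ℝ ((K : Finset (Amb k)) : Set (Amb k)),
        ENNReal.ofReal (absDet (tanB Γ H K x)) ∂(riemMeasure d) ∧
    |(riemMeasure d).real (closestPoint Γ '' S) - (riemMeasure d).real S| ≤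
      η * (riemMeasure d).real S := by
  have hm := h𝒦.mesh
  have : Finite (cells d 𝒦) := (hm.finite.subset fun K hK => hK.1).to_subtype
  have : Fintype (cells d 𝒦) := Fintype.ofFinite _
  have hmeas : ∀ K : Finset (Amb k), MeasurableSet (convexHull ℝ (K : Set (Amb k))) := fun K =>
    (isCompact_convexHull_finset K).measurableSet
  have hSt : S ⊆ tube Γ δ := hSs.trans h𝒦.subset_tube
  have hinj : InjOn (closestPoint Γ) S := h𝒦.bijOn.injOn.mono hSs
  have hcell : ∀ K ∈ cells d 𝒦, ∀ A ⊆ S, MeasurableSet A →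
      A ⊆ convexHull ℝ (K : Set (Amb k)) → riemMeasure d (closestPoint Γ '' A) =
        ∫⁻ x in A, ENNReal.ofReal (absDet (tanB Γ H K x)) ∂(riemMeasure d) :=
    fun K hK A hAS hA hAK => hH.riemMeasure_image hδ hK hA hAK (hAS.trans hSt)
      (hinj.mono hAS) fun x hx => (hB K hK x (hAK hx)).1
  have hfin : riemMeasure d S < ⊤ := by
    refine (measure_mono (hSs.trans hm.space_eq.subset)).trans_lt ?_
    refine (measure_iUnion_le _).trans_lt ?_
    rw [tsum_fintype]
    exact ENNReal.sum_lt_top.2 fun K _ => riemMeasure_convexHull_lt_top K.2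
  -- The area formula on each cell shows that `p` maps null sets to null sets, so cell overlaps
  -- remain negligible after projection.
  have hnull : ∀ A ⊆ S, MeasurableSet A → riemMeasure d A = 0 →
      riemMeasure d (closestPoint Γ '' A) = 0 := by
    intro A hAS hA hA0
    have hA' : A = ⋃ K : cells d 𝒦, A ∩ convexHull ℝ ((K : Finset (Amb k)) : Set (Amb k)) := by
      rw [← inter_iUnion, ← hm.space_eq, inter_eq_left.2 (hAS.trans hSs)]
    rw [hA', image_iUnion, measure_iUnion_null_iff]
    intro K
    rw [hcell K K.2 _ (inter_subset_left.trans hAS) (hA.inter (hmeas _)) inter_subset_right]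
    exact setLIntegral_measure_zero _ _ (measure_mono_null inter_subset_left hA0)
  have hsum : riemMeasure d (closestPoint Γ '' S) = ∑' K : cells d 𝒦,
      ∫⁻ x in S ∩ convexHull ℝ ((K : Finset (Amb k)) : Set (Amb k)),
        ENNReal.ofReal (absDet (tanB Γ H K x)) ∂(riemMeasure d) := by
    rw [hm.measure_eq_tsum hS hSs (hδ.contDiffOn.continuousOn.mono hSt) hinj hnull]
    exact tsum_congr fun K => hcell K K.2 _ inter_subset_left (hS.inter (hmeas _))
      inter_subset_right
  have hsumS : riemMeasure d S = ∑' K : cells d 𝒦, riemMeasure d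
      (S ∩ convexHull ℝ ((K : Finset (Amb k)) : Set (Amb k))) := by
    have h := hm.measure_eq_tsum (f := id) hS hSs continuousOn_id (injOn_id S)
      fun A _ _ h0 => by rwa [image_id]
    simpa only [image_id] using h
  refine ⟨hfin, hsum, ?_⟩
  -- The pointwise bounds `1 - η ≤ |B|_d ≤ 1 + η` are integrated cell by cell in `ℝ≥0∞`; finiteness
  -- of the measure of `S` then allows passing to real numbers.
  have hup : riemMeasure d (closestPoint Γ '' S) ≤ ENNReal.ofReal (1 + η) * riemMeasure d S := by
    rw [hsum, hsumS, ← ENNReal.tsum_mul_left]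
    refine ENNReal.tsum_le_tsum fun K => ?_
    rw [← setLIntegral_const]
    refine setLIntegral_mono' (hS.inter (hmeas _)) fun x hx => ENNReal.ofReal_le_ofReal ?_
    linarith [(abs_le.1 (hB K K.2 x hx.2).2).1]
  have hlow : ENNReal.ofReal (1 - η) * riemMeasure d S ≤ riemMeasure d (closestPoint Γ '' S) := by
    rw [hsum, hsumS, ← ENNReal.tsum_mul_left]
    refine ENNReal.tsum_le_tsum fun K => ?_
    rw [← setLIntegral_const]
    refine setLIntegral_mono' (hS.inter (hmeas _)) fun x hx => ENNReal.ofReal_le_ofReal ?_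
    linarith [(abs_le.1 (hB K K.2 x hx.2).2).2]
  have htop : ENNReal.ofReal (1 + η) * riemMeasure d S ≠ ⊤ :=
    ENNReal.mul_ne_top ENNReal.ofReal_ne_top hfin.ne
  have hup' := ENNReal.toReal_mono htop hup
  have hlow' := ENNReal.toReal_mono (hup.trans_lt htop.lt_top).ne hlow
  rw [ENNReal.toReal_mul, ENNReal.toReal_ofReal (by linarith)] at hup' hlow'
  rw [abs_le, Measure.real, Measure.real]
  constructor <;> linarith

end CutFEM

end

/-! ### Choice of the constants and assembly. -/

theorem mainTheorem10 (k d : ℕ) (Γ : Set (CutFEM.Amb k)) (hΓ : Γ.Nonempty) (hcpt : IsCompact Γ)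
    (hsm : CutFEM.IsSmoothSubmanifold d Γ) :
    ∃ δ₀ : ℝ, CutFEM.IsTubeRadius Γ δ₀ ∧
      (∃ H : CutFEM.Amb k → CutFEM.Amb k →L[ℝ] CutFEM.Amb k, CutFEM.IsTubeFactor Γ δ₀ H) ∧
      ∀ c : ℝ, ∃ C h₀ : ℝ, 0 < C ∧ 0 < h₀ ∧
        ∀ H : CutFEM.Amb k → CutFEM.Amb k →L[ℝ] CutFEM.Amb k, CutFEM.IsTubeFactor Γ δ₀ H →
        ∀ h : ℝ, 0 < h → h ≤ h₀ →
        ∀ 𝒦 : Geometry.SimplicialComplex ℝ (CutFEM.Amb k),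
          CutFEM.IsDiscreteManifold d Γ δ₀ c h 𝒦 →
          (∀ K ∈ CutFEM.cells d 𝒦, ∀ x ∈ convexHull ℝ (K : Set (CutFEM.Amb k)),
            ‖CutFEM.matB Γ H K x‖ ≤ C ∧
            (∃ e : vectorSpan ℝ (K : Set (CutFEM.Amb k)) ≃L[ℝ]
                CutFEM.tangentSpace Γ (CutFEM.closestPoint Γ x),
              (e : vectorSpan ℝ (K : Set (CutFEM.Amb k)) →L[ℝ]
                CutFEM.tangentSpace Γ (CutFEM.closestPoint Γ x)) = CutFEM.tanB Γ H K x ∧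
              ‖(e.symm : CutFEM.tangentSpace Γ (CutFEM.closestPoint Γ x) →L[ℝ]
                vectorSpan ℝ (K : Set (CutFEM.Amb k)))‖ ≤ C) ∧
            ‖CutFEM.tangentProj Γ (CutFEM.closestPoint Γ x) -
              CutFEM.matB Γ H K x ∘L ContinuousLinearMap.adjoint (CutFEM.matB Γ H K x)‖
                ≤ C * h ^ 2 ∧
            |1 - CutFEM.absDet (CutFEM.tanB Γ H K x)| ≤ C * h ^ 2 ∧
            CutFEM.absDet (CutFEM.tanB Γ H K x) ≤ C ∧
            0 < CutFEM.absDet (CutFEM.tanB Γ H K x) ∧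
            (CutFEM.absDet (CutFEM.tanB Γ H K x))⁻¹ ≤ C) ∧
          (∀ S : Set (CutFEM.Amb k), MeasurableSet S → S ⊆ 𝒦.space →
            CutFEM.riemMeasure d S < ⊤ ∧
            CutFEM.riemMeasure d (CutFEM.closestPoint Γ '' S) =
              ∑' K : CutFEM.cells d 𝒦,
                ∫⁻ x in S ∩ convexHull ℝ ((K : Finset (CutFEM.Amb k)) : Set (CutFEM.Amb k)),
                  ENNReal.ofReal (CutFEM.absDet (CutFEM.tanB Γ H K x))
                    ∂(CutFEM.riemMeasure d) ∧
            |(CutFEM.riemMeasure d).real (CutFEM.closestPoint Γ '' S) -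
                (CutFEM.riemMeasure d).real S|
              ≤ C * h ^ 2 * (CutFEM.riemMeasure d).real S) := by
  obtain ⟨δ, M, hδ, hM, hbd⟩ := CutFEM.exists_tube_bounds hΓ hcpt hsm
  refine ⟨δ, hδ, CutFEM.exists_isTubeFactor hM hbd, fun c => ?_⟩
  -- `a₀ * h ^ 2` bounds `‖Dp - P_Γ‖` on the mesh; `|c|` because `c` may be negative.
  set a₀ : ℝ := M * |c| with ha₀
  have ha₀0 : 0 ≤ a₀ := by positivity
  -- For `h ≤ 1`, `C₁ * h ^ 2` dominates `b ^ 2 + 2 * a + a ^ 2` with `a = a₀ * h ^ 2` and `b = c *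
  -- h`.
  set C₁ : ℝ := c ^ 2 + 2 * a₀ + a₀ ^ 2 with hC₁
  have hC₁0 : 0 ≤ C₁ := by positivity
  -- Dominates both `C₁` and the determinant constant `d * 2 ^ d * C₁`.
  set C₂ : ℝ := (d * 2 ^ d + 1) * C₁ with hC₂
  have hC₂0 : 0 ≤ C₂ := by positivity
  have hC₁₂ : C₁ ≤ C₂ := le_mul_of_one_le_left hC₁0 (by
    have : (0 : ℝ) ≤ d * 2 ^ d := by positivity
    linarith)
  have hC₂d : d * 2 ^ d * C₁ ≤ C₂ := by
    rw [hC₂]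
    gcongr
    linarith
  -- This `h₀` ensures `h ≤ 1` and `C₂ * h ^ 2 ≤ 1 / 2`: the relative error is at most `1 / 2`, and
  -- `|B|_d` lies in `[1/2, 3/2]`.
  have hh₀ : 0 < 1 / (1 + 2 * C₂) := by positivity
  -- The summand `2` covers `‖B⁻¹‖` and both bounds on `|B|_d`, `a₀` covers `‖B‖ ≤ 1 + a₀`, and `C₂`
  -- the `O(h²)` estimates.
  refine ⟨2 + a₀ + C₂, 1 / (1 + 2 * C₂), by positivity, hh₀, fun H hH h hh hhle 𝒦 h𝒦 => ?_⟩
  have hh1 : h ≤ 1 := hhle.trans (by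
    rw [div_le_one (by positivity)]
    linarith)
  have hC₂h : C₂ * h ^ 2 ≤ 1 / 2 := by
    have h1 : h * (1 + 2 * C₂) ≤ 1 := by
      rwa [le_div_iff₀ (by positivity)] at hhle
    nlinarith [mul_nonneg hC₂0 hh.le]
  have hsq : h ^ 2 ≤ 1 := pow_le_one₀ hh.le hh1
  have key : ∀ K ∈ CutFEM.cells d 𝒦, ∀ x ∈ convexHull ℝ (K : Set (CutFEM.Amb k)), _ :=
    fun K hK x hx => by
      have hxs : x ∈ 𝒦.space := 𝒦.convexHull_subset_space hK.1 hx
      have hxt := h𝒦.subset_tube hxs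
      have hD : ‖fderiv ℝ (CutFEM.closestPoint Γ) x -
          CutFEM.tangentProj Γ (CutFEM.closestPoint Γ x)‖ ≤ a₀ * h ^ 2 := by
        refine (hbd x hxt).2.2.trans ?_
        rw [ha₀, mul_assoc]
        refine mul_le_mul_of_nonneg_left ((h𝒦.dist_le x hxs).trans ?_) hM
        gcongr
        exact le_abs_self c
      refine hH.cell_estimates hcpt hΓ hsm hxt hK hD (h𝒦.proj_le K hK x hx)
        (ε := C₁ * h ^ 2) ?_ ?_
      · have h2 : (a₀ * h ^ 2) ^ 2 ≤ a₀ ^ 2 * h ^ 2 := by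
          rw [mul_pow]
          gcongr
          nlinarith [sq_nonneg h]
        rw [hC₁]
        linarith
      · exact (mul_le_mul_of_nonneg_right hC₁₂ (sq_nonneg h)).trans hC₂h
  have hdet : ∀ K ∈ CutFEM.cells d 𝒦, ∀ x ∈ convexHull ℝ (K : Set (CutFEM.Amb k)),
      |1 - CutFEM.absDet (CutFEM.tanB Γ H K x)| ≤ C₂ * h ^ 2 := fun K hK x hx => by
    refine (key K hK x hx).2.2.2.trans ?_
    rw [← mul_assoc]
    gcongr
  have hCC : C₂ * h ^ 2 ≤ (2 + a₀ + C₂) * h ^ 2 := by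
    gcongr
    linarith
  refine ⟨fun K hK x hx => ?_, fun S hS hSs => ?_⟩
  · obtain ⟨h1, ⟨e, he, he2⟩, h3, -⟩ := key K hK x hx
    have h4 := hdet K hK x hx
    have h5 := abs_le.1 (h4.trans hC₂h)
    refine ⟨h1.trans ?_, ⟨e, he, he2.trans (by linarith)⟩, h3.trans ?_, h4.trans hCC,
      by linarith, by linarith, ?_⟩
    · nlinarith
    · exact (mul_le_mul_of_nonneg_right hC₁₂ (sq_nonneg h)).trans hCC
    · refine (inv_le_of_inv_le₀ (by linarith) ?_)
      refine (inv_anti₀ two_pos (by linarith : (2 : ℝ) ≤ 2 + a₀ + C₂)).trans ?_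
      linarith
  · obtain ⟨h1, h2, h3⟩ := h𝒦.measure_estimates hδ hH (η := C₂ * h ^ 2)
      (fun K hK x hx => ⟨by
        obtain ⟨-, ⟨e, he, -⟩, -⟩ := key K hK x hx
        rw [← he]
        exact e.injective, hdet K hK x hx⟩) (by positivity) (by linarith) hS hSs
    exact ⟨h1, h2, h3.trans (mul_le_mul_of_nonneg_right hCC measureReal_nonneg)⟩
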